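/- Let $P=\{X_1,X_2,\dots\}$ be a stationary Poisson point process in $\mathbb{R}^2$ of intensity $\lambda>0$, let $r>0$ satisfy $\pi r^2\le 1$, let $k\ge 1$ be an integer, and let $R=[0,1]^2$. For $x\in\mathbb{R}^2$ and $m\ge 0$ let $\chi_m(x)=1$ if $x$ belongs to exactly $m$ of the closed discs of radius $r$ centred at the points $X_i$, and $\chi_m(x)=0$ otherwise. Let $$V_k=\sum_{m=0}^{k-1}\int_R\chi_m(x)\,dx$$ be the $k$-vacancy, i.e. the area of the part of $R$ that is covered by at most $k-1$ of the discs. Then $$\frac{1}{1+\theta}\;\le\;\mathsf{P}(V_k>0)\;\le\;2e^{-\lambda\pi r^2}\left(1+\lambda^2\pi r^2\left(1+\frac{2}{\lambda\pi r}\right)\sum_{i=0}^{k-1}\frac{(\lambda\pi r^2)^i}{i!}\right),$$ where $$\theta=\frac{4\,(k+1)!}{e^{-\lambda\pi r^2}\,\lambda\,(\lambda\pi r^2)^k}.$$ -/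

import Mathlib

open MeasureTheory ProbabilityTheory
open scoped Nat

noncomputable section

namespace KCoverage

/-- The number of points of the (enumerated) configuration `X 0 ω, X 1 ω, …` that lie in `B`. -/
def count {Ω : Type*} {d : ℕ} (X : ℕ → Ω → EuclideanSpace ℝ (Fin d))
    (B : Set (EuclideanSpace ℝ (Fin d))) (ω : Ω) : ℕ∞ :=
  Set.encard {i : ℕ | X i ω ∈ B}

/-- `X 0, X 1, …` is an enumeration of a stationary Poisson process in `ℝ^d` of intensity `lam`:
the number of points in a Borel set `B` of finite volume has the Poisson distribution of mean
`lam * volume B`, and the numbers of points in finitely many pairwise disjoint such sets are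
independent. -/
structure IsPoissonProcess {Ω : Type*} [MeasurableSpace Ω] (μ : Measure Ω) {d : ℕ}
    (lam : ℝ) (X : ℕ → Ω → EuclideanSpace ℝ (Fin d)) : Prop where
  measurable : ∀ i, Measurable (X i)
  poisson_count : ∀ B : Set (EuclideanSpace ℝ (Fin d)), MeasurableSet B → volume B ≠ ⊤ →
    ∀ n : ℕ, μ {ω | count X B ω = n} =
      poissonMeasure (lam.toNNReal * (volume B).toNNReal) {n}
  indep_count : ∀ (n : ℕ) (B : Fin n → Set (EuclideanSpace ℝ (Fin d))),
    (∀ j, MeasurableSet (B j)) → (∀ j, volume (B j) ≠ ⊤) →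
    Pairwise (fun i j => Disjoint (B i) (B j)) →
    iIndepFun (fun j ω => count X (B j) ω) μ

open Classical in
/-- `chi X r m x ω` is `1` if exactly `m` of the balls of radius `r` centred at the points
`X i ω` contain `x`, and `0` otherwise. -/
def chi {Ω : Type*} {d : ℕ} (X : ℕ → Ω → EuclideanSpace ℝ (Fin d)) (r : ℝ) (m : ℕ)
    (x : EuclideanSpace ℝ (Fin d)) (ω : Ω) : ℝ :=
  if Set.encard {i : ℕ | x ∈ Metric.closedBall (X i ω) r} = m then 1 else 0

/-- The `k`-vacancy within `R`: the volume of the part of `R` covered by at most `k - 1` balls. -/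
def vacancy {Ω : Type*} {d : ℕ} (X : ℕ → Ω → EuclideanSpace ℝ (Fin d)) (r : ℝ)
    (R : Set (EuclideanSpace ℝ (Fin d))) (k : ℕ) (ω : Ω) : ℝ :=
  ∑ m ∈ Finset.range k, ∫ x in R, chi X r m x ω

/-- The unit square `[0,1]²` in the Euclidean plane. -/
def unitSquare : Set (EuclideanSpace ℝ (Fin 2)) :=
  {x | ∀ i, x i ∈ Set.Icc (0 : ℝ) 1}

end KCoverage

end

/-! Write `a = λπr²` and let `P` be the probability that a Poisson variable of mean `a` is below
`k`; this is the probability that a given point is vacant, i.e. lies in fewer than `k` discs.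

Upper bound: count vertices of the vacant region. If it has positive area, its closure `K` is
compact, and a point of `K` at maximal distance from some centre `o` cannot have `K` on both sides
of it along a line. Near such a point the only obstacles are the sides of the square and the circles
through the point, and a circle tangent to a segment does not obstruct it. So the point is a corner,
a side-circle crossing or a circle-circle crossing (`IsFarthest.exists_vertex`), and it lies in
fewer than `k` open discs. Varying `o` gives three such points (`exists_isFarthest_ne`), so by
Markov's inequality `3 P(V_k > 0)` is at most the expected number of vacant vertices. A
Campbell-Mecke type inequality, obtained by discretisation
(`tsum_measure_location_le_of_partition`), says that the discs away from the generating centres may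
be treated as independent of the vertex. The expectation is thus at most `(4 + 16λr + 4πr²λ²) P`,
and elementary estimates (`min_vertex_bound_le`), together with the trivial bound 1, turn this into
the closed form.

Lower bound: `P(V_k > 0) ≥ (E V_k)² / E V_k²` by Cauchy-Schwarz. Here `E V_k = P`, and two points
`x`, `y` are both vacant only if `x` is vacant and the part of the disc at `y` outside the disc at
`x` has fewer than `k` centres. These regions are disjoint, hence independent, and the lune has area
at least `(πr/2)|x - y|` for `|x - y| ≤ 2r`. Integrating over the plane gives `E V_k² ≤ P (P + C)`
with explicit `C ≤ θP`. -/

namespace KCoverage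

open scoped ENNReal

/-! ### The Poisson distribution function -/

/-- The distribution function of the Poisson law of mean `m`: the probability of a value below
`k`. -/
noncomputable def poissonBelow (k : ℕ) (m : ℝ) : ℝ :=
  Real.exp (-m) * ∑ i ∈ Finset.range k, m ^ i / (i ! : ℝ)

lemma poissonBelow_nonneg (k : ℕ) {m : ℝ} (hm : 0 ≤ m) : 0 ≤ poissonBelow k m := by
  unfold poissonBelow; positivity

lemma continuous_poissonBelow (k : ℕ) : Continuous (poissonBelow k) := by
  unfold poissonBelow; fun_prop

/-- The derivatives of successive terms telescope, and only that of the last survives. Its sign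
gives the monotonicity used to replace a region by a smaller one. -/
lemma hasDerivAt_poissonBelow_succ (k : ℕ) (m : ℝ) :
    HasDerivAt (poissonBelow (k + 1)) (-(Real.exp (-m) * (m ^ k / (k ! : ℝ)))) m := by
  induction k with
  | zero =>
    have : poissonBelow (0 + 1) = fun m => Real.exp (-m) := by
      ext m; simp [poissonBelow]
    rw [this]
    simpa using (hasDerivAt_neg m).exp
  | succ k ih =>
    have : poissonBelow (k + 1 + 1) = fun m =>
        poissonBelow (k + 1) m + Real.exp (-m) * (m ^ (k + 1) / ((k + 1)! : ℝ)) := by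
      ext m
      simp only [poissonBelow]
      rw [Finset.sum_range_succ _ (k + 1)]; ring
    rw [this]
    have h1 : HasDerivAt (fun m : ℝ => Real.exp (-m)) (-Real.exp (-m)) m := by
      simpa using (hasDerivAt_neg m).exp
    have h2 : HasDerivAt (fun m : ℝ => m ^ (k + 1) / ((k + 1)! : ℝ)) (m ^ k / (k ! : ℝ)) m := by
      have := (hasDerivAt_pow (k + 1) m).div_const ((k + 1)! : ℝ)
      refine this.congr_deriv ?_
      rw [Nat.factorial_succ]
      push_cast
      have : (k ! : ℝ) ≠ 0 := by positivity
      field_simp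
    refine (ih.add (h1.mul h2)).congr_deriv ?_
    ring

lemma antitoneOn_poissonBelow (k : ℕ) : AntitoneOn (poissonBelow k) (Set.Ici 0) := by
  cases k with
  | zero => intro a _ b _ _; simp [poissonBelow]
  | succ k =>
    refine antitoneOn_of_deriv_nonpos (convex_Ici 0) (continuous_poissonBelow _).continuousOn
      (fun x _ => (hasDerivAt_poissonBelow_succ k x).differentiableAt.differentiableWithinAt) ?_
    intro x hx
    rw [interior_Ici, Set.mem_Ioi] at hx
    rw [(hasDerivAt_poissonBelow_succ k x).deriv]
    have : 0 ≤ Real.exp (-x) * (x ^ k / (k ! : ℝ)) := by positivity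
    linarith

/-! ### Counts of points: measurability, law and mean -/

section Counts

variable {Ω : Type*} {d : ℕ} {X : ℕ → Ω → EuclideanSpace ℝ (Fin d)}

lemma toENNReal_count (B : Set (EuclideanSpace ℝ (Fin d))) (ω : Ω) :
    (count X B ω : ℝ≥0∞) = ∑' i, (X i ⁻¹' B).indicator 1 ω := by
  rw [count, ← ENNReal.tsum_set_one]
  exact tsum_subtype _ fun _ => 1

lemma count_mono {B C : Set (EuclideanSpace ℝ (Fin d))} (h : B ⊆ C) (ω : Ω) :
    count X B ω ≤ count X C ω :=
  Set.encard_le_encard fun _ hi => h hi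

variable [MeasurableSpace Ω]

/-- The parameter is arbitrary so that the lemma also serves for balls with a random centre and for
joint measurability in the point and the outcome. -/
lemma measurable_count_param {α : Type*} [MeasurableSpace α] {S : ℕ → Set α}
    (hS : ∀ i, MeasurableSet (S i)) : Measurable fun a => Set.encard {i : ℕ | a ∈ S i} := by
  have h : ∀ a, (Set.encard {i : ℕ | a ∈ S i} : ℝ≥0∞) = ∑' i, (S i).indicator 1 a := by
    intro a
    rw [← ENNReal.tsum_set_one]
    exact tsum_subtype _ fun _ => 1
  have hm : Measurable fun a => (Set.encard {i : ℕ | a ∈ S i} : ℝ≥0∞) := by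
    simp_rw [h]
    exact Measurable.tsum fun i => measurable_one.indicator (hS i)
  refine ENat.measurable_iff.2 fun n => ?_
  have : (fun a => Set.encard {i : ℕ | a ∈ S i}) ⁻¹' {(n : ℕ∞)} =
      (fun a => (Set.encard {i : ℕ | a ∈ S i} : ℝ≥0∞)) ⁻¹' {((n : ℕ∞) : ℝ≥0∞)} := by
    ext a
    simp only [Set.mem_preimage, Set.mem_singleton_iff]
    exact ENat.toENNReal_inj.symm
  rw [this]
  exact hm (measurableSet_singleton _)

lemma measurable_count (hX : ∀ i, Measurable (X i)) {B : Set (EuclideanSpace ℝ (Fin d))}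
    (hB : MeasurableSet B) : Measurable (count X B) :=
  measurable_count_param fun i => hX i hB

variable {μ : Measure Ω} {lam : ℝ}

lemma IsPoissonProcess.measure_count_eq (hX : IsPoissonProcess μ lam X) (hlam : 0 ≤ lam)
    {B : Set (EuclideanSpace ℝ (Fin d))} (hB : MeasurableSet B) (hB' : volume B ≠ ⊤) (n : ℕ) :
    μ {ω | count X B ω = n} = ENNReal.ofReal
      (Real.exp (-(lam * volume.real B)) * (lam * volume.real B) ^ n / (n ! : ℝ)) := by
  rw [hX.poisson_count B hB hB', poissonMeasure_singleton]
  simp [Real.coe_toNNReal _ hlam, Measure.real, ENNReal.coe_toNNReal_eq_toReal]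

lemma IsPoissonProcess.measure_count_lt (hX : IsPoissonProcess μ lam X) (hlam : 0 ≤ lam)
    {B : Set (EuclideanSpace ℝ (Fin d))} (hB : MeasurableSet B) (hB' : volume B ≠ ⊤) (k : ℕ) :
    μ {ω | count X B ω < k} = ENNReal.ofReal (poissonBelow k (lam * volume.real B)) := by
  induction k with
  | zero => simp [poissonBelow]
  | succ k ih =>
    have h1 : {ω | count X B ω < (k + 1 : ℕ)} =
        {ω | count X B ω < k} ∪ {ω | count X B ω = k} := by
      ext ω
      simp only [Set.mem_ofPred_eq, Set.mem_union]
      push_cast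
      rw [ENat.lt_add_one_iff (ENat.natCast_ne_top k), le_iff_lt_or_eq]
    have hm := measurable_count hX.measurable hB
    have hnn : 0 ≤ lam * volume.real B := by positivity
    rw [h1, measure_union _ (show MeasurableSet {ω | count X B ω = k} from
      hm (measurableSet_singleton _)), ih, hX.measure_count_eq hlam hB hB',
      ← ENNReal.ofReal_add (poissonBelow_nonneg k hnn) (by positivity)]
    · congr 1
      unfold poissonBelow
      rw [Finset.sum_range_succ]; ring
    · exact Set.disjoint_left.2 fun ω h2 h3 => by
        simp only [Set.mem_ofPred_eq] at h2 h3
        rw [h3] at h2; exact lt_irrefl _ h2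

/-- The Poisson weights of the finite values already sum to one, so no mass is left at `⊤`. -/
lemma IsPoissonProcess.ae_count_lt_top [IsProbabilityMeasure μ] (hX : IsPoissonProcess μ lam X)
    {B : Set (EuclideanSpace ℝ (Fin d))} (hB : MeasurableSet B) (hB' : volume B ≠ ⊤) :
    ∀ᵐ ω ∂μ, count X B ω < ⊤ := by
  have hm := measurable_count hX.measurable hB
  have h1 : {ω | count X B ω < ⊤} = ⋃ n : ℕ, {ω | count X B ω = n} := by
    ext ω
    simp only [Set.mem_ofPred_eq, Set.mem_iUnion, lt_top_iff_ne_top, ENat.ne_top_iff_exists]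
    exact exists_congr fun n => eq_comm
  have h2 : μ {ω | count X B ω < ⊤} = 1 := by
    rw [h1, measure_iUnion]
    · have h3 := hasSum_one_poissonMeasure (lam.toNNReal * (volume B).toNNReal)
      simp_rw [hX.poisson_count B hB hB', poissonMeasure_singleton]
      rw [← ENNReal.ofReal_tsum_of_nonneg _ h3.summable, h3.tsum_eq, ENNReal.ofReal_one]
      intro n; positivity
    · intro m n hmn
      refine Set.disjoint_left.2 fun ω h2 h3 => hmn ?_
      simp only [Set.mem_ofPred_eq] at h2 h3
      exact_mod_cast h2.symm.trans h3
    · exact fun n => hm (measurableSet_singleton _)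
  rw [← prob_compl_eq_zero_iff (show MeasurableSet {ω | count X B ω < ⊤} from
    hm (Set.to_countable (Set.Iio ⊤)).measurableSet)] at h2
  exact h2

lemma IsPoissonProcess.lintegral_count [IsProbabilityMeasure μ] (hX : IsPoissonProcess μ lam X)
    (hlam : 0 ≤ lam)
    {B : Set (EuclideanSpace ℝ (Fin d))} (hB : MeasurableSet B) (hB' : volume B ≠ ⊤) :
    ∫⁻ ω, (count X B ω : ℝ≥0∞) ∂μ = ENNReal.ofReal lam * volume B := by
  have hm := measurable_count hX.measurable hB
  have h1 : ∀ᵐ ω ∂μ, (count X B ω : ℝ≥0∞) =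
      ∑' n : ℕ, (n : ℝ≥0∞) * (count X B ⁻¹' {(n : ℕ∞)}).indicator 1 ω := by
    filter_upwards [hX.ae_count_lt_top hB hB'] with ω hω
    obtain ⟨n, hn⟩ := ENat.ne_top_iff_exists.1 hω.ne
    rw [tsum_eq_single n]
    · simp [← hn]
    · intro m hm
      have : ω ∉ count X B ⁻¹' {(m : ℕ∞)} := by
        simp only [Set.mem_preimage, Set.mem_singleton_iff, ← hn]
        exact_mod_cast hm.symm
      simp [this]
  rw [lintegral_congr_ae h1, lintegral_tsum]
  · have h2 : ∀ n : ℕ, ∫⁻ ω, (n : ℝ≥0∞) * (count X B ⁻¹' {(n : ℕ∞)}).indicator 1 ω ∂μ =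
        ENNReal.ofReal (n * (Real.exp (-(lam * volume.real B)) *
          (lam * volume.real B) ^ n / (n ! : ℝ))) := by
      intro n
      rw [lintegral_const_mul _ (measurable_one.indicator (hm (measurableSet_singleton _))),
        lintegral_indicator_one (hm (measurableSet_singleton _)),
        ENNReal.ofReal_mul (by positivity), ← hX.measure_count_eq hlam hB hB', ENNReal.ofReal_natCast]
      rfl
    set m := lam * volume.real B with hmdef
    have hm0 : 0 ≤ m := by positivity
    have h3 : HasSum (fun n : ℕ => n * (Real.exp (-m) * m ^ n / (n ! : ℝ))) m := by
      -- The term at 0 vanishes; after the shift, `n + 1` times the weight at `n + 1` is `m` times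
      -- the weight at `n`.
      rw [hasSum_nat_add_iff' 1 |>.symm]
      simp only [Finset.range_one, Finset.sum_singleton, CharP.cast_eq_zero, zero_mul, sub_zero]
      have := (hasSum_one_poissonMeasure m.toNNReal).mul_left m
      rw [mul_one] at this
      simp only [Real.coe_toNNReal _ hm0] at this
      refine this.congr_fun ?_
      intro n
      rw [Nat.factorial_succ]
      push_cast
      have : (n ! : ℝ) ≠ 0 := by positivity
      field_simp
      ring
    simp_rw [h2]
    rw [← ENNReal.ofReal_tsum_of_nonneg _ h3.summable, h3.tsum_eq, hmdef,
      ENNReal.ofReal_mul hlam, ofReal_measureReal hB']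
    intro n; positivity
  · exact fun n => ((measurable_one.indicator (hm (measurableSet_singleton _))).const_mul _).aemeasurable

end Counts

end KCoverage

/-! ### Intensity of points and pairs on the event that a disjoint region has few points -/

namespace KCoverage

open scoped ENNReal

/-- The Euclidean plane. -/
abbrev Plane : Type := EuclideanSpace ℝ (Fin 2)

section Independence

variable {Ω : Type*} {d : ℕ} {X : ℕ → Ω → EuclideanSpace ℝ (Fin d)}
  [MeasurableSpace Ω] {μ : Measure Ω} [IsProbabilityMeasure μ] {lam : ℝ}

lemma IsPoissonProcess.setLIntegral_count (hX : IsPoissonProcess μ lam X) (hlam : 0 ≤ lam)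
    {A D : Set (EuclideanSpace ℝ (Fin d))} (hA : MeasurableSet A) (hD : MeasurableSet D)
    (hA' : volume A ≠ ⊤) (hD' : volume D ≠ ⊤) (hAD : Disjoint A D) (k : ℕ) :
    ∫⁻ ω in {ω | count X D ω < k}, (count X A ω : ℝ≥0∞) ∂μ =
      ENNReal.ofReal lam * volume A * ENNReal.ofReal (poissonBelow k (lam * volume.real D)) := by
  have hE : MeasurableSet {ω | count X D ω < k} :=
    measurable_count hX.measurable hD (Set.to_countable (Set.Iio (k : ℕ∞))).measurableSet
  have hind := hX.indep_count 2 ![A, D] (by simp [Fin.forall_fin_two, hA, hD])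
    (by simp [Fin.forall_fin_two, hA', hD'])
    (by intro i j hij; fin_cases i <;> fin_cases j <;> simp_all [hAD.symm])
  have h2 : IndepFun (count X A) (count X D) μ := hind.indepFun (i := 0) (j := 1) (by simp)
  have h3 := h2.comp
    (Measurable.of_discrete (f := fun n : ℕ∞ => (n : ℝ≥0∞)))
    (Measurable.of_discrete (f := (Set.Iio (k : ℕ∞)).indicator fun _ => (1 : ℝ≥0∞)))
  have h4 := lintegral_mul_eq_lintegral_mul_lintegral_of_indepFun
    (Measurable.of_discrete.comp (measurable_count hX.measurable hA))
    (Measurable.of_discrete.comp (measurable_count hX.measurable hD)) h3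
  rw [← lintegral_indicator hE, ← hX.measure_count_lt hlam hD hD', ← hX.lintegral_count hlam hA hA',
    ← lintegral_indicator_one hE]
  refine Eq.trans ?_ h4
  congr 1
  ext ω
  by_cases h : count X D ω < k <;> simp [h]

lemma IsPoissonProcess.setLIntegral_count_mul_count (hX : IsPoissonProcess μ lam X)
    (hlam : 0 ≤ lam) {A B D : Set (EuclideanSpace ℝ (Fin d))} (hA : MeasurableSet A)
    (hB : MeasurableSet B) (hD : MeasurableSet D)
    (hA' : volume A ≠ ⊤) (hB' : volume B ≠ ⊤) (hD' : volume D ≠ ⊤) (hAB : Disjoint A B)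
    (hAD : Disjoint A D) (hBD : Disjoint B D) (k : ℕ) :
    ∫⁻ ω in {ω | count X D ω < k}, (count X A ω : ℝ≥0∞) * count X B ω ∂μ =
      ENNReal.ofReal lam * volume A * (ENNReal.ofReal lam * volume B) *
        ENNReal.ofReal (poissonBelow k (lam * volume.real D)) := by
  have hE : MeasurableSet {ω | count X D ω < k} :=
    measurable_count hX.measurable hD (Set.to_countable (Set.Iio (k : ℕ∞))).measurableSet
  have hind := hX.indep_count 3 ![A, B, D] (by simp [Fin.forall_fin_succ, hA, hB, hD])
    (by simp [Fin.forall_fin_succ, hA', hB', hD'])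
    (by intro i j hij; fin_cases i <;> fin_cases j <;>
      simp_all [hAD.symm, hBD.symm, hAB.symm])
  have hmA := measurable_count hX.measurable hA
  have hmB := measurable_count hX.measurable hB
  have hmD := measurable_count hX.measurable hD
  have h1 : IndepFun (count X A) (count X B) μ := hind.indepFun (i := 0) (j := 1) (by simp)
  have h2 : IndepFun (fun ω => (count X A ω, count X B ω)) (count X D) μ := by
    refine hind.indepFun_prodMk ?_ 0 1 2 (by simp) (by simp)
    simp only [Fin.forall_fin_succ]
    exact ⟨hmA, hmB, hmD, fun i => i.elim0⟩
  have h3 := h2.comp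
    (Measurable.of_discrete (f := fun n : ℕ∞ × ℕ∞ => (n.1 : ℝ≥0∞) * n.2))
    (Measurable.of_discrete (f := (Set.Iio (k : ℕ∞)).indicator fun _ => (1 : ℝ≥0∞)))
  have h3' := h1.comp
    (Measurable.of_discrete (f := fun n : ℕ∞ => (n : ℝ≥0∞)))
    (Measurable.of_discrete (f := fun n : ℕ∞ => (n : ℝ≥0∞)))
  have h4 := lintegral_mul_eq_lintegral_mul_lintegral_of_indepFun
    (Measurable.of_discrete.comp (hmA.prodMk hmB)) (Measurable.of_discrete.comp hmD) h3
  have h5 := lintegral_mul_eq_lintegral_mul_lintegral_of_indepFun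
    (Measurable.of_discrete.comp hmA) (Measurable.of_discrete.comp hmB) h3'
  rw [← lintegral_indicator hE, ← hX.measure_count_lt hlam hD hD', ← hX.lintegral_count hlam hA hA',
    ← hX.lintegral_count hlam hB hB', ← lintegral_indicator_one hE]
  refine Eq.trans ?_ (h4.trans (congrArg₂ (· * ·) h5 ?_))
  · congr 1
    ext ω
    by_cases h : count X D ω < k <;> simp [h]
  · congr 1

/-- The elementary substitute for the Campbell-Mecke formula: by independence, restricting to an
event decided off `A` only rescales the intensity on `A`. -/
lemma IsPoissonProcess.tsum_measure_mem (hX : IsPoissonProcess μ lam X) (hlam : 0 ≤ lam)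
    {A D : Set (EuclideanSpace ℝ (Fin d))} (hA : MeasurableSet A) (hD : MeasurableSet D)
    (hA' : volume A ≠ ⊤) (hD' : volume D ≠ ⊤) (hAD : Disjoint A D) (k : ℕ) :
    ∑' i, μ {ω | X i ω ∈ A ∧ count X D ω < k} =
      ENNReal.ofReal lam * volume A * ENNReal.ofReal (poissonBelow k (lam * volume.real D)) := by
  rw [← hX.setLIntegral_count hlam hA hD hA' hD' hAD k]
  simp_rw [toENNReal_count]
  rw [lintegral_tsum fun i => (measurable_one.indicator (hX.measurable i hA)).aemeasurable]
  refine tsum_congr fun i => ?_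
  rw [lintegral_indicator_one (hX.measurable i hA), Measure.restrict_apply (hX.measurable i hA)]
  rfl

lemma IsPoissonProcess.tsum_measure_mem_prod (hX : IsPoissonProcess μ lam X) (hlam : 0 ≤ lam)
    {A B D : Set (EuclideanSpace ℝ (Fin d))} (hA : MeasurableSet A)
    (hB : MeasurableSet B) (hD : MeasurableSet D)
    (hA' : volume A ≠ ⊤) (hB' : volume B ≠ ⊤) (hD' : volume D ≠ ⊤) (hAB : Disjoint A B)
    (hAD : Disjoint A D) (hBD : Disjoint B D) (k : ℕ) :
    ∑' p : ℕ × ℕ, μ {ω | (X p.1 ω ∈ A ∧ X p.2 ω ∈ B) ∧ count X D ω < k} =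
      ENNReal.ofReal lam * volume A * (ENNReal.ofReal lam * volume B) *
        ENNReal.ofReal (poissonBelow k (lam * volume.real D)) := by
  rw [← hX.setLIntegral_count_mul_count hlam hA hB hD hA' hB' hD' hAB hAD hBD k]
  have h1 : ∀ ω, (count X A ω : ℝ≥0∞) * count X B ω =
      ∑' p : ℕ × ℕ, ((X p.1 ⁻¹' A) ∩ (X p.2 ⁻¹' B)).indicator 1 ω := by
    intro ω
    rw [toENNReal_count, toENNReal_count, ENNReal.tsum_prod (f := fun i j => ((X i ⁻¹' A) ∩ (X j ⁻¹' B)).indicator 1 ω),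
      ← ENNReal.tsum_mul_right]
    refine tsum_congr fun i => ?_
    rw [← ENNReal.tsum_mul_left]
    refine tsum_congr fun j => ?_
    rw [Set.inter_indicator_one]; rfl
  have hm : ∀ p : ℕ × ℕ, MeasurableSet ((X p.1 ⁻¹' A) ∩ (X p.2 ⁻¹' B)) :=
    fun p => (hX.measurable _ hA).inter (hX.measurable _ hB)
  simp_rw [h1]
  rw [lintegral_tsum fun p => (measurable_one.indicator (hm p)).aemeasurable]
  refine tsum_congr fun p => ?_
  rw [lintegral_indicator_one (hm p), Measure.restrict_apply (hm p)]
  rfl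

lemma IsPoissonProcess.tsum_measure_pair_mem (hX : IsPoissonProcess μ lam X) (hlam : 0 ≤ lam)
    {A B D : Set (EuclideanSpace ℝ (Fin d))} (hA : MeasurableSet A)
    (hB : MeasurableSet B) (hD : MeasurableSet D)
    (hA' : volume A ≠ ⊤) (hB' : volume B ≠ ⊤) (hD' : volume D ≠ ⊤) (hAB : Disjoint A B)
    (hAD : Disjoint A D) (hBD : Disjoint B D) (k : ℕ)
    {S : Set (EuclideanSpace ℝ (Fin d) × EuclideanSpace ℝ (Fin d))} (hS : MeasurableSet S)
    (hSAB : S ⊆ A ×ˢ B) :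
    ∑' p : ℕ × ℕ, μ {ω | (X p.1 ω, X p.2 ω) ∈ S ∧ count X D ω < k} =
      ENNReal.ofReal lam ^ 2 * (volume.prod volume) S *
        ENNReal.ofReal (poissonBelow k (lam * volume.real D)) := by
  set E := {ω | count X D ω < k} with hEdef
  set P := ENNReal.ofReal (poissonBelow k (lam * volume.real D))
  have hXm : ∀ p : ℕ × ℕ, Measurable fun ω => (X p.1 ω, X p.2 ω) :=
    fun p => (hX.measurable _).prodMk (hX.measurable _)
  let ν : Measure (EuclideanSpace ℝ (Fin d) × EuclideanSpace ℝ (Fin d)) :=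
    Measure.sum fun p : ℕ × ℕ => (μ.restrict E).map fun ω => (X p.1 ω, X p.2 ω)
  have hν : ∀ T, MeasurableSet T →
      ν T = ∑' p : ℕ × ℕ, μ {ω | (X p.1 ω, X p.2 ω) ∈ T ∧ count X D ω < k} := by
    intro T hT
    rw [Measure.sum_apply _ hT]
    refine tsum_congr fun p => ?_
    rw [Measure.map_apply (hXm p) hT, Measure.restrict_apply (hXm p hT)]
    rfl
  have hfA : IsFiniteMeasure (volume.restrict A) := isFiniteMeasure_restrict.2 hA'
  have hfB : IsFiniteMeasure (volume.restrict B) := isFiniteMeasure_restrict.2 hB'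
  have hsf : IsFiniteMeasure ((ENNReal.ofReal lam * (ENNReal.ofReal lam * P)) •
      volume.restrict A) := Measure.smul_finite _ (by finiteness)
  -- The pair intensity is known on rectangles; uniqueness of product measures extends it to every
  -- measurable subset of `A ×ˢ B`.
  have key : ((ENNReal.ofReal lam * (ENNReal.ofReal lam * P)) • volume.restrict A).prod
      (volume.restrict B) = ν.restrict (A ×ˢ B) := by
    refine Measure.prod_eq fun s t hs ht => ?_
    rw [Measure.restrict_apply (hs.prod ht), Set.prod_inter_prod, hν _ ((hs.inter hA).prod
      (ht.inter hB)), Measure.smul_apply, Measure.restrict_apply hs, Measure.restrict_apply ht]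
    have := hX.tsum_measure_mem_prod hlam (hs.inter hA) (ht.inter hB) hD
      (measure_ne_top_of_subset Set.inter_subset_right hA')
      (measure_ne_top_of_subset Set.inter_subset_right hB') hD'
      (hAB.mono Set.inter_subset_right Set.inter_subset_right)
      (hAD.mono_left Set.inter_subset_right) (hBD.mono_left Set.inter_subset_right) k
    refine Eq.trans this ?_
    rw [smul_eq_mul]; ring
  rw [← hν S hS, ← Set.inter_eq_left.2 hSAB, ← Measure.restrict_apply hS, ← key,
    Measure.prod_smul_left, Measure.prod_restrict, Measure.smul_apply, Measure.restrict_apply hS,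
    smul_eq_mul]
  ring

end Independence

end KCoverage

/-! ### Campbell-Mecke inequality by discretisation -/

namespace KCoverage

open scoped ENNReal

lemma volumeReal_ball_plane (x : Plane) {r : ℝ} (hr : 0 ≤ r) :
    volume.real (Metric.ball x r) = Real.pi * r ^ 2 := by
  rw [Measure.real, EuclideanSpace.volume_ball_fin_two, ENNReal.toReal_mul, ENNReal.toReal_pow,
    ENNReal.toReal_ofReal hr, ENNReal.toReal_ofReal Real.pi_pos.le]
  ring

lemma volumeReal_closedBall_plane (x : Plane) {r : ℝ} (hr : 0 ≤ r) :
    volume.real (Metric.closedBall x r) = Real.pi * r ^ 2 := by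
  rw [Measure.real, EuclideanSpace.volume_closedBall_fin_two, ENNReal.toReal_mul,
    ENNReal.toReal_pow, ENNReal.toReal_ofReal hr, ENNReal.toReal_ofReal Real.pi_pos.le]
  ring

/-- A separable metric space is partitioned into countably many measurable sets of small radius. -/
lemma exists_measurable_partition_subset_ball (E : Type*) [PseudoMetricSpace E] [MeasurableSpace E]
    [OpensMeasurableSpace E] [TopologicalSpace.SeparableSpace E] [Nonempty E] {δ : ℝ} (hδ : 0 < δ) :
    ∃ (C : ℕ → Set E) (c : ℕ → E), (∀ n, MeasurableSet (C n)) ∧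
      Pairwise (fun m n => Disjoint (C m) (C n)) ∧ (⋃ n, C n = Set.univ) ∧
      ∀ n, C n ⊆ Metric.ball (c n) δ := by
  refine ⟨disjointed fun n => Metric.ball (TopologicalSpace.denseSeq E n) δ,
    TopologicalSpace.denseSeq E, fun n => ?_, disjoint_disjointed _, ?_, fun n =>
      disjointed_subset _ n⟩
  · exact MeasurableSet.disjointed (fun i => Metric.isOpen_ball.measurableSet) n
  · rw [iUnion_disjointed, Set.eq_univ_iff_forall]
    intro x
    obtain ⟨n, hn⟩ := (TopologicalSpace.denseRange_denseSeq E).exists_dist_lt x hδ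
    exact Set.mem_iUnion.2 ⟨n, hn⟩

variable {Ω : Type*} [MeasurableSpace Ω] {μ : Measure Ω} {lam : ℝ}
  {X : ℕ → Ω → Plane}

/-- Points `Z i` of an auxiliary process are assigned locations `q (Z i)`. If, within each cell of a
partition, the process `Z` has intensity `ν` independently of the number of points away from a
small set `W`, then the expected number of points whose location is covered fewer than `k` times
is at most what it would be if location and covering were independent, up to an error due to
discretisation. -/
lemma tsum_measure_location_le_of_partition (hlam : 0 ≤ lam)
    {Y ι κ : Type*} [MeasurableSpace Y] [Countable ι] [Countable κ] {Z : ι → Ω → Y}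
    {ν : Measure Y} {G : Set Y} (hG : MeasurableSet G) {q : Y → Plane} (hq : Measurable q)
    {k : ℕ} {r δ w : ℝ} (hδ : 0 < δ) (hδr : δ ≤ r) (hw : w ≤ Real.pi * (r - δ) ^ 2)
    {C : κ → Set Y} (hCm : ∀ a, MeasurableSet (C a))
    (hCd : Pairwise fun a b => Disjoint (C a) (C b)) (hCu : ⋃ a, C a = Set.univ)
    {W : κ → Set Plane} (hWm : ∀ a, MeasurableSet (W a)) (hWw : ∀ a, volume.real (W a) ≤ w)
    (hWt : ∀ a, volume (W a) ≠ ⊤)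
    (H : ∀ a S D, MeasurableSet S → S ⊆ C a ∩ G → MeasurableSet D → volume D ≠ ⊤ →
      Disjoint (W a) D → ∑' i, μ {ω | Z i ω ∈ S ∧ count X D ω < k} ≤
        ν S * ENNReal.ofReal (poissonBelow k (lam * volume.real D))) :
    ∑' i, μ {ω | Z i ω ∈ G ∧ count X (Metric.ball (q (Z i ω)) r) ω < k} ≤
      ν G * ENNReal.ofReal (poissonBelow k (lam * (Real.pi * (r - δ) ^ 2 - w))) := by
  obtain ⟨B, c, hBm, hBd, hBu, hBc⟩ := exists_measurable_partition_subset_ball Plane hδ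
  -- The cells are refined so that on each of them the location `q` is known up to `δ`.
  let S : κ × ℕ → Set Y := fun t => (C t.1 ∩ G) ∩ q ⁻¹' B t.2
  have hSm : ∀ t, MeasurableSet (S t) := fun t => ((hCm _).inter hG).inter (hq (hBm _))
  have hSd : Pairwise fun s t => Disjoint (S s) (S t) := by
    intro s t hst
    by_cases h1 : s.1 = t.1
    · have h2 : s.2 ≠ t.2 := fun h2 => hst (Prod.ext h1 h2)
      exact ((hBd h2).preimage q).mono Set.inter_subset_right Set.inter_subset_right
    · exact (hCd h1).mono (fun x hx => hx.1.1) (fun x hx => hx.1.1)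
  have hSu : ⋃ t, S t = G := by
    ext y
    simp only [Set.mem_iUnion, S]
    refine ⟨fun ⟨t, ht⟩ => ht.1.2, fun hy => ?_⟩
    obtain ⟨a, ha⟩ := Set.mem_iUnion.1 (hCu.symm ▸ Set.mem_univ y)
    obtain ⟨n, hn⟩ := Set.mem_iUnion.1 (hBu.symm ▸ Set.mem_univ (q y))
    exact ⟨(a, n), ⟨ha, hy⟩, hn⟩
  -- The ball of radius `r - δ` about the cell centre lies in the ball of radius `r` about any
  -- location in the cell. Removing `W` makes the region disjoint from the generating points and
  -- costs area at most `w`.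
  let D : κ × ℕ → Set Plane := fun t => Metric.ball (c t.2) (r - δ) \ W t.1
  have hDm : ∀ t, MeasurableSet (D t) := fun t => Metric.isOpen_ball.measurableSet.diff (hWm _)
  have hDt : ∀ t, volume (D t) ≠ ⊤ := fun t =>
    measure_ne_top_of_subset Set.sdiff_subset measure_ball_lt_top.ne
  have hDv : ∀ t, Real.pi * (r - δ) ^ 2 - w ≤ volume.real (D t) := by
    intro t
    have := le_measureReal_sdiff (μ := volume) (s₁ := Metric.ball (c t.2) (r - δ)) (s₂ := W t.1) (hWt _)
    rw [volumeReal_ball_plane _ (by linarith)] at this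
    linarith [hWw t.1]
  have hP : ∀ t, poissonBelow k (lam * volume.real (D t)) ≤
      poissonBelow k (lam * (Real.pi * (r - δ) ^ 2 - w)) := by
    intro t
    refine antitoneOn_poissonBelow k ?_ ?_ (mul_le_mul_of_nonneg_left (hDv t) hlam)
    · exact mul_nonneg hlam (by linarith)
    · exact mul_nonneg hlam measureReal_nonneg
  calc ∑' i, μ {ω | Z i ω ∈ G ∧ count X (Metric.ball (q (Z i ω)) r) ω < k}
      ≤ ∑' i, ∑' t, μ {ω | Z i ω ∈ S t ∧ count X (D t) ω < k} := by
        refine ENNReal.tsum_le_tsum fun i => le_trans (measure_mono ?_) (measure_iUnion_le _)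
        rintro ω ⟨h1, h2⟩
        rw [← hSu] at h1
        obtain ⟨t, ht⟩ := Set.mem_iUnion.1 h1
        refine Set.mem_iUnion.2 ⟨t, ht, lt_of_le_of_lt (count_mono ?_ ω) h2⟩
        refine Set.sdiff_subset.trans (Metric.ball_subset_ball' ?_)
        have := Metric.mem_ball'.1 (hBc _ ht.2)
        linarith
    _ = ∑' t, ∑' i, μ {ω | Z i ω ∈ S t ∧ count X (D t) ω < k} := ENNReal.tsum_comm
    _ ≤ ∑' t, ν (S t) * ENNReal.ofReal (poissonBelow k (lam * (Real.pi * (r - δ) ^ 2 - w))) := by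
        refine ENNReal.tsum_le_tsum fun t => (H t.1 (S t) (D t) (hSm t) Set.inter_subset_left (hDm t)
          (hDt t) Set.disjoint_sdiff_right).trans ?_
        gcongr
        exact hP t
    _ = _ := by
        rw [ENNReal.tsum_mul_right, ← measure_iUnion (fun s t h => hSd h) hSm, hSu]

lemma tendsto_poissonBelow_discretisation (k : ℕ) (lam r : ℝ) (c : ℝ≥0∞) (hc : c ≠ ⊤) (m : ℝ) :
    Filter.Tendsto (fun δ : ℝ =>
      c * ENNReal.ofReal (poissonBelow k (lam * (Real.pi * (r - δ) ^ 2 - m * (Real.pi * δ ^ 2)))))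
      (nhdsWithin 0 (Set.Ioi 0))
      (nhds (c * ENNReal.ofReal (poissonBelow k (lam * (Real.pi * r ^ 2))))) := by
  refine ENNReal.Tendsto.const_mul (ENNReal.tendsto_ofReal ?_) (Or.inr hc)
  have h : Continuous fun δ : ℝ =>
      poissonBelow k (lam * (Real.pi * (r - δ) ^ 2 - m * (Real.pi * δ ^ 2))) :=
    (continuous_poissonBelow k).comp (by fun_prop)
  have := (h.tendsto 0).mono_left (nhdsWithin_le_nhds (s := Set.Ioi 0))
  simpa using this

lemma eventually_discretisation {r : ℝ} (hr : 0 < r) (m : ℝ) :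
    ∀ᶠ δ in nhdsWithin (0 : ℝ) (Set.Ioi 0), 0 < δ ∧ δ ≤ r ∧
      m * (Real.pi * δ ^ 2) ≤ Real.pi * (r - δ) ^ 2 := by
  have h1 : ∀ᶠ δ in nhdsWithin (0 : ℝ) (Set.Ioi 0), 0 < δ := self_mem_nhdsWithin
  have h2 : ∀ᶠ δ in nhdsWithin (0 : ℝ) (Set.Ioi 0), δ < r :=
    nhdsWithin_le_nhds (Iio_mem_nhds hr)
  have h3 : ∀ᶠ δ in nhds (0 : ℝ), 0 < Real.pi * (r - δ) ^ 2 - m * (Real.pi * δ ^ 2) := by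
    have h : Continuous fun δ : ℝ => Real.pi * (r - δ) ^ 2 - m * (Real.pi * δ ^ 2) := by fun_prop
    refine h.continuousAt.eventually_mem (Ioi_mem_nhds ?_)
    have := Real.pi_pos
    simp only [sub_zero, ne_eq, OfNat.ofNat_ne_zero, not_false_eq_true, zero_pow, mul_zero]
    positivity
  filter_upwards [h1, h2, nhdsWithin_le_nhds h3] with δ a b c
  exact ⟨a, b.le, by linarith⟩

variable [IsProbabilityMeasure μ]

/-- The expected number of points with location `q (X i)` covered fewer than `k` times. -/
lemma IsPoissonProcess.tsum_measure_location_le (hX : IsPoissonProcess μ lam X)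
    (hlam : 0 ≤ lam) {G : Set Plane} (hG : MeasurableSet G) (hGt : volume G ≠ ⊤)
    {q : Plane → Plane} (hq : Measurable q) (k : ℕ) {r : ℝ} (hr : 0 < r) :
    ∑' i, μ {ω | X i ω ∈ G ∧ count X (Metric.ball (q (X i ω)) r) ω < k} ≤
      ENNReal.ofReal lam * volume G *
        ENNReal.ofReal (poissonBelow k (lam * (Real.pi * r ^ 2))) := by
  -- The bound is proved for small `δ` and passed to the limit; the parameter 1 is the number of
  -- cells removed, each of area at most `πδ²`.
  refine ge_of_tendsto (tendsto_poissonBelow_discretisation k lam r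
    (ENNReal.ofReal lam * volume G) (by finiteness) 1) ?_
  filter_upwards [eventually_discretisation hr 1] with δ ⟨hδ, hδr, hδw⟩
  obtain ⟨C, c, hCm, hCd, hCu, hCc⟩ := exists_measurable_partition_subset_ball Plane hδ
  have hCt : ∀ n, volume (C n) ≠ ⊤ := fun n =>
    measure_ne_top_of_subset (hCc n) measure_ball_lt_top.ne
  refine tsum_measure_location_le_of_partition hlam (ν := ENNReal.ofReal lam • volume) hG hq hδ
    hδr hδw hCm hCd hCu hCm (fun a => ?_) hCt ?_
  · rw [one_mul, ← volumeReal_ball_plane (c a) hδ.le]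
    exact measureReal_mono (hCc a) measure_ball_lt_top.ne
  · intro a S D hS hSC hD hDt hCD
    have hSC' : S ⊆ C a := hSC.trans Set.inter_subset_left
    exact (hX.tsum_measure_mem hlam hS hD (measure_ne_top_of_subset hSC' (hCt a)) hDt
      (hCD.mono_left hSC') k).le

/-- The separation `ε` forces the two points into different cells once the cell radius is below `ε /
2`, and different cells carry independent counts. -/
lemma IsPoissonProcess.tsum_measure_pair_location_le_of_lt_dist (hX : IsPoissonProcess μ lam X)
    (hlam : 0 ≤ lam) {G : Set (Plane × Plane)} (hG : MeasurableSet G)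
    (hGt : (volume.prod volume) G ≠ ⊤) {ε : ℝ} (hε : 0 < ε) (hGε : ∀ p ∈ G, ε < dist p.1 p.2)
    {q : Plane × Plane → Plane} (hq : Measurable q) (k : ℕ) {r : ℝ} (hr : 0 < r) :
    ∑' i : ℕ × ℕ, μ {ω | (X i.1 ω, X i.2 ω) ∈ G ∧
        count X (Metric.ball (q (X i.1 ω, X i.2 ω)) r) ω < k} ≤
      ENNReal.ofReal lam ^ 2 * (volume.prod volume) G *
        ENNReal.ofReal (poissonBelow k (lam * (Real.pi * r ^ 2))) := by
  refine ge_of_tendsto (tendsto_poissonBelow_discretisation k lam r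
    (ENNReal.ofReal lam ^ 2 * (volume.prod volume) G) (by finiteness) 2) ?_
  have hev : ∀ᶠ δ in nhdsWithin (0 : ℝ) (Set.Ioi 0), δ < ε / 2 :=
    nhdsWithin_le_nhds (Iio_mem_nhds (by linarith))
  filter_upwards [eventually_discretisation hr 2, hev] with δ ⟨hδ, hδr, hδw⟩ hδε
  obtain ⟨C, c, hCm, hCd, hCu, hCc⟩ := exists_measurable_partition_subset_ball Plane hδ
  have hCt : ∀ n, volume (C n) ≠ ⊤ := fun n =>
    measure_ne_top_of_subset (hCc n) measure_ball_lt_top.ne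
  have hCv : ∀ n, volume.real (C n) ≤ Real.pi * δ ^ 2 := fun n => by
    rw [← volumeReal_ball_plane (c n) hδ.le]
    exact measureReal_mono (hCc n) measure_ball_lt_top.ne
  refine tsum_measure_location_le_of_partition hlam (Z := fun i : ℕ × ℕ => fun ω => (X i.1 ω, X i.2 ω))
    (ν := ENNReal.ofReal lam ^ 2 • volume.prod volume) hG hq hδ
    hδr hδw (C := fun a : ℕ × ℕ => C a.1 ×ˢ C a.2) (W := fun a => C a.1 ∪ C a.2)
    (fun a => (hCm _).prod (hCm _)) ?_ ?_ (fun a => (hCm _).union (hCm _)) (fun a => ?_)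
    (fun a => measure_union_ne_top (hCt _) (hCt _)) ?_
  · intro a b hab
    rw [Set.disjoint_prod]
    by_cases h1 : a.1 = b.1
    · exact Or.inr (hCd fun h2 => hab (Prod.ext h1 h2))
    · exact Or.inl (hCd h1)
  · rw [Set.eq_univ_iff_forall]
    rintro ⟨x, y⟩
    obtain ⟨a, ha⟩ := Set.mem_iUnion.1 (hCu.symm ▸ Set.mem_univ x)
    obtain ⟨b, hb⟩ := Set.mem_iUnion.1 (hCu.symm ▸ Set.mem_univ y)
    exact Set.mem_iUnion.2 ⟨(a, b), ha, hb⟩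
  · linarith [measureReal_union_le (μ := volume) (C a.1) (C a.2), hCv a.1, hCv a.2]
  · intro a S D hS hSC hD hDt hCD
    -- A diagonal rectangle contains only pairs at distance below `2δ < ε`, so it misses `G`.
    by_cases haa : a.1 = a.2
    · have : S = ∅ := by
        refine Set.eq_empty_of_forall_notMem fun p hp => ?_
        obtain ⟨⟨h1, h2⟩, h3⟩ := hSC hp
        have h4 := Metric.mem_ball.1 (hCc _ h1)
        have h5 := Metric.mem_ball'.1 (hCc _ h2)
        rw [← haa] at h5
        linarith [hGε p h3, dist_triangle p.1 (c a.1) p.2]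
      simp [this]
    · rw [Set.disjoint_union_left] at hCD
      exact (hX.tsum_measure_pair_mem hlam (hCm _) (hCm _) hD (hCt _) (hCt _) hDt (hCd haa)
        hCD.1 hCD.2 k hS (hSC.trans Set.inter_subset_left)).le

/-- The expected number of pairs of distinct points with location `q (X i, X j)` covered fewer
than `k` times. -/
lemma IsPoissonProcess.tsum_measure_pair_location_le (hX : IsPoissonProcess μ lam X)
    (hlam : 0 ≤ lam) {G : Set (Plane × Plane)} (hG : MeasurableSet G)
    (hGt : (volume.prod volume) G ≠ ⊤) (hGne : ∀ p ∈ G, p.1 ≠ p.2)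
    {q : Plane × Plane → Plane} (hq : Measurable q) (k : ℕ) {r : ℝ} (hr : 0 < r) :
    ∑' i : ℕ × ℕ, μ {ω | (X i.1 ω, X i.2 ω) ∈ G ∧
        count X (Metric.ball (q (X i.1 ω, X i.2 ω)) r) ω < k} ≤
      ENNReal.ofReal lam ^ 2 * (volume.prod volume) G *
        ENNReal.ofReal (poissonBelow k (lam * (Real.pi * r ^ 2))) := by
  -- Pairs off the diagonal are exhausted by layers with a positive lower bound on the distance.
  let L : ℕ → Set (Plane × Plane) := fun n => {p | p ∈ G ∧ 1 / ((n : ℝ) + 1) < dist p.1 p.2}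
  have hLm : ∀ n, MeasurableSet (L n) := fun n =>
    hG.inter (measurableSet_lt measurable_const (measurable_fst.dist measurable_snd))
  let T : ℕ → Set (Plane × Plane) := disjointed L
  have hTm : ∀ n, MeasurableSet (T n) := fun n => MeasurableSet.disjointed hLm n
  have hTL : ∀ n, T n ⊆ L n := disjointed_subset L
  have hTu : ⋃ n, T n = G := by
    rw [iUnion_disjointed]
    ext p
    simp only [Set.mem_iUnion]
    refine ⟨fun ⟨n, hn⟩ => hn.1, fun hp => ?_⟩
    obtain ⟨n, hn⟩ := exists_nat_one_div_lt (dist_pos.2 (hGne p hp))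
    exact ⟨n, hp, hn⟩
  have hTd : Pairwise (fun m n => Disjoint (T m) (T n)) := disjoint_disjointed L
  calc _ ≤ ∑' i : ℕ × ℕ, ∑' n, μ {ω | (X i.1 ω, X i.2 ω) ∈ T n ∧
        count X (Metric.ball (q (X i.1 ω, X i.2 ω)) r) ω < k} := by
        refine ENNReal.tsum_le_tsum fun i => le_trans (measure_mono ?_) (measure_iUnion_le _)
        rintro ω ⟨h1, h2⟩
        rw [← hTu] at h1
        obtain ⟨n, hn⟩ := Set.mem_iUnion.1 h1
        exact Set.mem_iUnion.2 ⟨n, hn, h2⟩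
    _ = ∑' n, ∑' i : ℕ × ℕ, μ {ω | (X i.1 ω, X i.2 ω) ∈ T n ∧
        count X (Metric.ball (q (X i.1 ω, X i.2 ω)) r) ω < k} := ENNReal.tsum_comm
    _ ≤ ∑' n, ENNReal.ofReal lam ^ 2 * (volume.prod volume) (T n) *
        ENNReal.ofReal (poissonBelow k (lam * (Real.pi * r ^ 2))) := by
        refine ENNReal.tsum_le_tsum fun n =>
          hX.tsum_measure_pair_location_le_of_lt_dist hlam (hTm n) ?_
            (ε := 1 / ((n : ℝ) + 1)) (by positivity) (fun p hp => (hTL n hp).2) hq k hr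
        exact measure_ne_top_of_subset (fun p hp => (hTL n hp).1) hGt
    _ = _ := by
        rw [ENNReal.tsum_mul_right, ENNReal.tsum_mul_left,
          ← measure_iUnion (fun s t h => hTd h) hTm, hTu]

end KCoverage

/-! ### Farthest points of the vacant region -/

namespace KCoverage

open scoped ENNReal

lemma dist_sq_plane (x y : Plane) : dist x y ^ 2 = (x 0 - y 0) ^ 2 + (x 1 - y 1) ^ 2 := by
  rw [EuclideanSpace.dist_eq, Real.sq_sqrt (by positivity), Fin.sum_univ_two, Real.dist_eq,
    Real.dist_eq, sq_abs, sq_abs]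

lemma inner_plane (x y : Plane) : inner ℝ x y = x 0 * y 0 + x 1 * y 1 := by
  rw [PiLp.inner_apply, Fin.sum_univ_two]
  simp [mul_comm]

lemma plane_ext {x y : Plane} (h0 : x 0 = y 0) (h1 : x 1 = y 1) : x = y := by
  ext i
  fin_cases i
  · exact h0
  · exact h1

lemma isClosed_unitSquare : IsClosed unitSquare := by
  have : unitSquare = ⋂ i : Fin 2, {x : Plane | x i ∈ Set.Icc (0 : ℝ) 1} := by
    ext x; simp [unitSquare]
  rw [this]
  exact isClosed_iInter fun i => isClosed_Icc.preimage (by fun_prop)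

lemma isBounded_unitSquare : Bornology.IsBounded unitSquare := by
  refine (Metric.isBounded_closedBall (x := (0 : Plane)) (r := 2)).subset fun x hx => ?_
  rw [Metric.mem_closedBall]
  have h := dist_sq_plane x 0
  have h0 := hx 0
  have h1 := hx 1
  simp only [PiLp.zero_apply, sub_zero] at h
  have h3 : dist x 0 ^ 2 ≤ 2 ^ 2 := by
    rw [h]; nlinarith [h0.1, h0.2, h1.1, h1.2]
  exact le_of_sq_le_sq h3 (by norm_num)

/-- The part of the unit square covered by fewer than `k` of the closed discs of radius `r` centred
at the points `c i`. -/
def vacant (c : ℕ → Plane) (r : ℝ) (k : ℕ) : Set Plane :=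
  {x ∈ unitSquare | Set.encard {i : ℕ | x ∈ Metric.closedBall (c i) r} < k}

/-- `x` is a point of `K` at maximal distance from some point. -/
def IsFarthest (K : Set Plane) (x : Plane) : Prop :=
  x ∈ K ∧ ∃ o, ∀ y ∈ K, dist y o ≤ dist x o

/-- By the parallelogram law the squared distances of `x + t` and `x - t` from `o` average to `‖x -
o‖² + ‖t‖²`, so one of them beats `x`. -/
lemma IsFarthest.not_mem_and_mem {K : Set Plane} {x t : Plane} (hx : IsFarthest K x)
    (ht : t ≠ 0) : ¬ (x + t ∈ K ∧ x - t ∈ K) := by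
  rintro ⟨h1, h2⟩
  obtain ⟨-, o, ho⟩ := hx
  have h3 := ho _ h1
  have h4 := ho _ h2
  rw [dist_eq_norm, dist_eq_norm] at h3 h4
  have h5 := parallelogram_law_with_norm ℝ (x - o) t
  have e1 : x + t - o = x - o + t := by abel
  have e2 : x - t - o = x - o - t := by abel
  rw [e1] at h3
  rw [e2] at h4
  have h6 := norm_pos_iff.2 ht
  nlinarith [norm_nonneg (x - o + t), norm_nonneg (x - o - t), norm_nonneg (x - o)]

/-- A compact plane set of positive area has a farthest point different from two given ones. -/
lemma exists_isFarthest_ne {K U : Set Plane} (hK : IsCompact K) (hUK : U ⊆ K) (hU : volume U ≠ 0)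
    (a b : Plane) : ∃ x, IsFarthest K x ∧ x ≠ a ∧ x ≠ b := by
  -- A normal to the line through `a` and `b`. That line is a null set, so `U` has a point `u` off
  -- it.
  obtain ⟨n₀, hn₀, hab₀⟩ : ∃ n : Plane, n ≠ 0 ∧ inner ℝ n (b - a) = 0 := by
    by_cases h : b = a
    · refine ⟨EuclideanSpace.single 0 1, ?_, by simp [h]⟩
      simp
    · refine ⟨!₂[-(b 1 - a 1), b 0 - a 0], fun h0 => h ?_, ?_⟩
      · have h1 := congrArg (fun v : Plane => v 0) h0
        have h2 := congrArg (fun v : Plane => v 1) h0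
        simp at h1 h2
        exact plane_ext (by linarith) (by linarith)
      · rw [inner_plane]; simp; ring
  obtain ⟨u, huU, hu⟩ : ∃ u ∈ U, inner ℝ n₀ (u - a) ≠ 0 := by
    by_contra! hcon
    apply hU
    have h1 : U ⊆ (fun u => u - a) ⁻¹' ((ℝ ∙ n₀)ᗮ : Submodule ℝ Plane) := fun u hu => by
      simp only [Set.mem_preimage, SetLike.mem_coe, Submodule.mem_orthogonal_singleton_iff_inner_right]
      exact hcon u hu
    refine measure_mono_null h1 ?_
    simp_rw [sub_eq_add_neg]
    rw [measure_preimage_add_right]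
    refine Measure.addHaar_submodule _ _ fun htop => hn₀ ?_
    have : n₀ ∈ (ℝ ∙ n₀)ᗮ := htop ▸ Submodule.mem_top
    rw [Submodule.mem_orthogonal_singleton_iff_inner_right] at this
    exact inner_self_eq_zero.1 this
  obtain ⟨n, hn, hab⟩ : ∃ n : Plane, 0 < inner ℝ n (u - a) ∧ inner ℝ n (b - a) = 0 := by
    rcases lt_or_gt_of_ne hu with h | h
    · exact ⟨-n₀, by rw [inner_neg_left]; linarith, by rw [inner_neg_left, hab₀, neg_zero]⟩
    · exact ⟨n₀, h, hab₀⟩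
  -- With this `T`, the squared distance from `o` exceeds `‖T • n‖²` by 0 at `a`, by `‖b - a‖²` at
  -- `b`, and by `‖u - a‖² + ‖b - a‖²` at `u`. So neither `a` nor `b` is farthest from `o`.
  set T : ℝ := ‖b - a‖ ^ 2 / (2 * inner ℝ n (u - a)) with hT
  have hTn : 2 * T * inner ℝ n (u - a) = ‖b - a‖ ^ 2 := by
    rw [hT]; field_simp
  set o : Plane := a - T • n with ho
  have hkey : ∀ z, dist z o ^ 2 = ‖z - a‖ ^ 2 + 2 * T * inner ℝ n (z - a) + ‖T • n‖ ^ 2 := by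
    intro z
    have : z - o = (z - a) + T • n := by rw [ho]; abel
    rw [dist_eq_norm, this, norm_add_sq_real, real_inner_smul_right, real_inner_comm]
    ring
  have hua : 0 < ‖u - a‖ := by
    rw [norm_pos_iff]
    intro h; rw [h, inner_zero_right] at hn; exact lt_irrefl _ hn
  obtain ⟨x, hxK, hx⟩ := hK.exists_isMaxOn ⟨u, hUK huU⟩
    (f := fun z => dist z o) (by fun_prop)
  have hxu : dist u o ≤ dist x o := hx (hUK huU)
  refine ⟨x, ⟨hxK, o, fun y hy => hx hy⟩, ?_, ?_⟩
  · rintro rfl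
    have h1 := hkey x
    have h2 := hkey u
    have h3 : dist u o ^ 2 ≤ dist x o ^ 2 := by gcongr
    simp only [sub_self, norm_zero, inner_zero_right] at h1
    nlinarith [sq_nonneg ‖b - x‖]
  · rintro rfl
    have h1 := hkey x
    have h2 := hkey u
    have h3 : dist u o ^ 2 ≤ dist x o ^ 2 := by gcongr
    rw [hab] at h1
    nlinarith

section Vacant

variable {c : ℕ → Plane} {r : ℝ} {k : ℕ} {x : Plane}

/-- Lying in `k` given open discs is an open condition, so it would persist at nearby vacant points.
This is why the bound passes to the closure only for open discs. -/
lemma encard_lt_of_mem_closure_vacant (hx : x ∈ closure (vacant c r k)) :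
    Set.encard {i | c i ∈ Metric.ball x r} < k := by
  by_contra! h
  obtain ⟨s, hs, hsk⟩ := Set.exists_subset_encard_eq h
  have hsf : s.Finite := Set.finite_of_encard_eq_coe hsk
  have hev : ∀ᶠ y in nhds x, ∀ i ∈ s, dist (c i) y < r := by
    rw [Filter.eventually_all_finite hsf]
    intro i hi
    have hc : Continuous fun y => dist (c i) y := by fun_prop
    exact hc.continuousAt.eventually_mem (Iio_mem_nhds (Metric.mem_ball.1 (hs hi)))
  obtain ⟨y, hy1, hy2⟩ := mem_closure_iff_nhds.1 hx _ hev
  refine absurd hy2.2 (not_lt.2 ?_)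
  rw [← hsk]
  exact Set.encard_le_encard fun i hi => Metric.mem_closedBall'.2 (hy1 i hi).le

/-- By local finiteness, discs not containing `x` stay away from nearby points. If also the discs
with `x` on their boundary are avoided, only the open discs containing `x` remain, and they are
fewer than `k`. -/
lemma eventually_mem_vacant (hc : ∀ ρ, {i | dist x (c i) ≤ ρ}.Finite)
    (hx : x ∈ closure (vacant c r k)) :
    ∀ᶠ y in nhds x, y ∈ unitSquare → (∀ i, dist x (c i) = r → r < dist y (c i)) →
      y ∈ vacant c r k := by
  have h1 : ∀ᶠ y in nhds x, ∀ i ∈ {i | dist x (c i) ≤ r + 1}, r < dist x (c i) → r < dist y (c i) := by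
    rw [Filter.eventually_all_finite (hc (r + 1))]
    intro i hi
    rw [Filter.eventually_imp_distrib_left]
    intro h
    have hc : Continuous fun y => dist y (c i) := by fun_prop
    exact hc.continuousAt.eventually_mem (Ioi_mem_nhds h)
  filter_upwards [h1, Metric.ball_mem_nhds x one_pos] with y hy hyx hyR hyb
  refine ⟨hyR, lt_of_le_of_lt (Set.encard_le_encard fun i hi => ?_)
    (encard_lt_of_mem_closure_vacant hx)⟩
  have hi' : dist y (c i) ≤ r := Metric.mem_closedBall.1 hi
  have hyx' : dist x y < 1 := Metric.mem_ball'.1 hyx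
  rw [Set.mem_ofPred_eq, Metric.mem_ball']
  rcases lt_trichotomy (dist x (c i)) r with h | h | h
  · exact h
  · exact absurd (hyb i h) (not_lt.2 hi')
  · refine absurd (hy i ?_ h) (not_lt.2 hi')
    linarith [dist_triangle x y (c i)]

/-- At a farthest point, in every direction admissible for the square, some circle through the point
is not tangent. -/
lemma IsFarthest.exists_inner_ne_zero (hc : ∀ ρ, {i | dist x (c i) ≤ ρ}.Finite)
    (hx : IsFarthest (closure (vacant c r k)) x) {t : Plane} (ht : t ≠ 0)
    (htR : ∀ᶠ ε in nhds (0 : ℝ), x + ε • t ∈ unitSquare) :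
    ∃ i, dist x (c i) = r ∧ inner ℝ (x - c i) t ≠ 0 := by
  by_contra! hcon
  have hcont : Continuous fun ε : ℝ => x + ε • t := by fun_prop
  have h1 : ∀ᶠ ε in nhds (0 : ℝ), x + ε • t ∈ unitSquare →
      (∀ i, dist x (c i) = r → r < dist (x + ε • t) (c i)) → x + ε • t ∈ vacant c r k := by
    have := hcont.tendsto 0
    simp only [zero_smul, add_zero] at this
    exact this.eventually (eventually_mem_vacant hc hx.1)
  -- Moving along a tangent leaves the disc in both directions, since the squared distance becomes
  -- `r² + ‖ε • t‖²`. If all circles through `x` were tangent to `t`, both `x + ε • t` and `x - ε •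
  -- t` would be vacant.
  have h2 : ∀ ε : ℝ, ε ≠ 0 → ∀ i, dist x (c i) = r → r < dist (x + ε • t) (c i) := by
    intro ε hε i hi
    have e : x + ε • t - c i = (x - c i) + ε • t := by abel
    have h3 : dist (x + ε • t) (c i) ^ 2 = r ^ 2 + ‖ε • t‖ ^ 2 := by
      rw [dist_eq_norm, e, norm_add_sq_real, real_inner_smul_right, hcon i hi, ← hi, dist_eq_norm]
      ring
    have h4 : 0 < ‖ε • t‖ := norm_pos_iff.2 (smul_ne_zero hε ht)
    refine lt_of_pow_lt_pow_left₀ 2 dist_nonneg ?_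
    rw [h3]; nlinarith
  have h3 := h1.and htR
  have h4 : ∀ᶠ ε in nhds (0 : ℝ), ((x + (-ε) • t ∈ unitSquare →
      (∀ i, dist x (c i) = r → r < dist (x + (-ε) • t) (c i)) → x + (-ε) • t ∈ vacant c r k) ∧
      x + (-ε) • t ∈ unitSquare) := by
    have := (continuous_neg (G := ℝ)).tendsto 0
    rw [neg_zero] at this
    exact this.eventually h3
  obtain ⟨ε, ⟨hε1, hε2⟩, hε⟩ := (((h3.and h4).filter_mono nhdsWithin_le_nhds).and
    (self_mem_nhdsWithin (s := Set.Ioi (0 : ℝ)))).exists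
  have hε0 : ε ≠ 0 := ne_of_gt hε
  refine hx.not_mem_and_mem (t := ε • t) (smul_ne_zero hε0 ht) ⟨subset_closure
    (hε1.1 hε1.2 (h2 ε hε0)), ?_⟩
  rw [sub_eq_add_neg, ← neg_smul]
  exact subset_closure (hε2.1 hε2.2 (h2 (-ε) (neg_ne_zero.2 hε0)))

end Vacant

/-! ### Explicit crossings -/

/-- One of the two intersection points of the circles of radius `r` centred at `p.1` and `p.2`; the
other one is `crossing r p.swap`. -/
noncomputable def crossing (r : ℝ) (p : Plane × Plane) : Plane :=
  !₂[(p.1 0 + p.2 0) / 2 - √(r ^ 2 / ((p.2 0 - p.1 0) ^ 2 + (p.2 1 - p.1 1) ^ 2) - 1 / 4) *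
      (p.2 1 - p.1 1),
    (p.1 1 + p.2 1) / 2 + √(r ^ 2 / ((p.2 0 - p.1 0) ^ 2 + (p.2 1 - p.1 1) ^ 2) - 1 / 4) *
      (p.2 0 - p.1 0)]

/-- Measured from the midpoint of the centres, `x` is orthogonal to `b - a`, hence `τ` times the
rotated vector. The radius fixes `τ²`, and the sign of `τ` selects the order of the centres. -/
lemma eq_crossing_or_eq_crossing {r : ℝ} {a b x : Plane} (hab : a ≠ b) (ha : dist x a = r)
    (hb : dist x b = r) : x = crossing r (a, b) ∨ x = crossing r (b, a) := by
  have h1 := dist_sq_plane x a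
  have h2 := dist_sq_plane x b
  rw [ha] at h1
  rw [hb] at h2
  set V := (b 0 - a 0) ^ 2 + (b 1 - a 1) ^ 2 with hV
  have hV' : (a 0 - b 0) ^ 2 + (a 1 - b 1) ^ 2 = V := by rw [hV]; ring
  have hVpos : 0 < V := by
    have h3 := dist_sq_plane b a
    rw [← hV] at h3
    rw [← h3]
    have := dist_pos.2 hab.symm
    positivity
  set w0 := x 0 - (a 0 + b 0) / 2 with hw0
  set w1 := x 1 - (a 1 + b 1) / 2 with hw1
  have horth : w0 * (b 0 - a 0) + w1 * (b 1 - a 1) = 0 := by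
    rw [hw0, hw1]; linarith
  set τ := (w1 * (b 0 - a 0) - w0 * (b 1 - a 1)) / V with hτ
  have e0 : w0 = -(τ * (b 1 - a 1)) := by
    rw [hτ]; field_simp
    rw [hV]; linear_combination (b 0 - a 0) * horth
  have e1 : w1 = τ * (b 0 - a 0) := by
    rw [hτ]; field_simp
    rw [hV]; linear_combination (b 1 - a 1) * horth
  have hsq : τ ^ 2 = r ^ 2 / V - 1 / 4 := by
    have h5 : r ^ 2 = τ ^ 2 * V + V / 4 := by
      rw [h1]
      have f0 : x 0 - a 0 = w0 + (b 0 - a 0) / 2 := by rw [hw0]; ring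
      have f1 : x 1 - a 1 = w1 + (b 1 - a 1) / 2 := by rw [hw1]; ring
      rw [f0, f1, e0, e1, hV]; ring
    rw [h5]; field_simp; ring
  have hs : √(r ^ 2 / V - 1 / 4) = |τ| := by rw [← hsq, Real.sqrt_sq_eq_abs]
  rcases le_total 0 τ with h | h
  · left
    rw [abs_of_nonneg h] at hs
    refine plane_ext ?_ ?_
    · simp only [crossing, ← hV, hs]
      simp; linarith
    · simp only [crossing, ← hV, hs]
      simp; linarith
  · right
    rw [abs_of_nonpos h] at hs
    refine plane_ext ?_ ?_
    · simp only [crossing, hV', hs]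
      simp; linarith
    · simp only [crossing, hV', hs]
      simp; linarith

/-- An intersection point of the line `{x | x (m + 1) = b}` with the circle of radius `r` centred
at `c`; the sign `s` selects one of the two. -/
noncomputable def sideCrossing (r : ℝ) (m : Fin 2) (b s : ℝ) (c : Plane) : Plane :=
  WithLp.toLp 2 fun i => if i = m then c m + s * √(r ^ 2 - (b - c (m + 1)) ^ 2) else b

lemma dist_sq_plane' (m : Fin 2) (x y : Plane) :
    dist x y ^ 2 = (x m - y m) ^ 2 + (x (m + 1) - y (m + 1)) ^ 2 := by
  rw [dist_sq_plane]
  fin_cases m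
  · simp
  · simp [add_comm]

lemma eq_sideCrossing {r : ℝ} (m : Fin 2) {x c : Plane} (h : dist x c = r) :
    x = sideCrossing r m (x (m + 1)) 1 c ∨ x = sideCrossing r m (x (m + 1)) (-1) c := by
  have h1 := dist_sq_plane' m x c
  rw [h] at h1
  have h2 : √(r ^ 2 - (x (m + 1) - c (m + 1)) ^ 2) = |x m - c m| := by
    rw [← Real.sqrt_sq_eq_abs]; congr 1; linarith
  have hm : m + 1 ≠ m := by fin_cases m <;> simp
  have hm' : ∀ i, i ≠ m → i = m + 1 := by
    intro i hi; fin_cases m <;> fin_cases i <;> simp_all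
  rcases le_total 0 (x m - c m) with h3 | h3
  · left
    ext i
    by_cases hi : i = m
    · simp [sideCrossing, hi, h2, abs_of_nonneg h3]
    · simp [sideCrossing, hm' i hi, hm]
  · right
    ext i
    by_cases hi : i = m
    · simp [sideCrossing, hi, h2, abs_of_nonpos h3]
    · simp [sideCrossing, hm' i hi, hm]

end KCoverage

/-! ### Vertices of the vacant region -/

namespace KCoverage

open scoped ENNReal

/-- The numbers `0` and `1`, the end points of the unit interval. -/
def bit (b : Bool) : ℝ := if b then 1 else 0

/-- The signs `1` and `-1`. -/
def sgn (b : Bool) : ℝ := if b then 1 else -1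

/-- The corners of the unit square. -/
def corner (v : Fin 2 → Bool) : Plane := WithLp.toLp 2 fun i => bit (v i)

/-- The centres of the circles for which the crossing with a given side exists. -/
def sideSet (r : ℝ) (t : Fin 2 × Bool × Bool) : Set Plane :=
  {c | |bit t.2.1 - c (t.1 + 1)| ≤ r ∧
    c t.1 + sgn t.2.2 * √(r ^ 2 - (bit t.2.1 - c (t.1 + 1)) ^ 2) ∈ Set.Icc (0 : ℝ) 1}

/-- The pairs of centres whose circles have a crossing in the unit square. -/
def crossingSet (r : ℝ) : Set (Plane × Plane) :=
  {p | p.1 ≠ p.2 ∧ dist p.1 p.2 ≤ 2 * r ∧ crossing r p ∈ unitSquare}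

/-- Labels for the potential vertices of the vacant region: corners of the square, crossings of a
side with a circle, crossings of two circles. -/
abbrev Vertex : Type := (Fin 2 → Bool) ⊕ ((Fin 2 × Bool × Bool) × ℕ) ⊕ (ℕ × ℕ)

/-- The location of a vertex. -/
noncomputable def Vertex.loc (c : ℕ → Plane) (r : ℝ) : Vertex → Plane
  | .inl v => corner v
  | .inr (.inl (t, i)) => sideCrossing r t.1 (bit t.2.1) (sgn t.2.2) (c i)
  | .inr (.inr p) => crossing r (c p.1, c p.2)

/-- The vertex exists. -/
def Vertex.Exists (c : ℕ → Plane) (r : ℝ) : Vertex → Prop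
  | .inl _ => True
  | .inr (.inl (t, i)) => c i ∈ sideSet r t
  | .inr (.inr p) => (c p.1, c p.2) ∈ crossingSet r

/-- The cases are the numbers of coordinates of `x` in `{0, 1}`: two give a corner; one leaves the
direction of a side free, so a circle passes through `x` on that side; none leaves all directions
free, which yields two distinct circles. -/
lemma IsFarthest.exists_vertex {c : ℕ → Plane} {r : ℝ} {k : ℕ} {x : Plane} (hr : 0 < r)
    (hc : ∀ ρ, {i | dist x (c i) ≤ ρ}.Finite) (hx : IsFarthest (closure (vacant c r k)) x) :
    ∃ v : Vertex, v.Exists c r ∧ v.loc c r = x := by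
  have hxR : x ∈ unitSquare :=
    closure_minimal (fun y hy => hy.1) isClosed_unitSquare hx.1
  by_cases h : ∀ i, x i = 0 ∨ x i = 1
  · refine ⟨.inl fun i => decide (x i = 1), trivial, ?_⟩
    ext i
    rcases h i with h | h <;> simp [Vertex.loc, corner, bit, h]
  push Not at h
  obtain ⟨m, hm0, hm1⟩ := h
  have hmI : x m ∈ Set.Ioo (0 : ℝ) 1 :=
    ⟨lt_of_le_of_ne (hxR m).1 hm0.symm, lt_of_le_of_ne (hxR m).2 hm1⟩
  have hne : m + 1 ≠ m := by fin_cases m <;> simp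
  have hor : ∀ i, i = m ∨ i = m + 1 := by
    intro i; fin_cases m <;> fin_cases i <;> simp
  have hev : ∀ (j : Fin 2) (t : Plane), x j ∈ Set.Ioo (0 : ℝ) 1 →
      ∀ᶠ ε in nhds (0 : ℝ), (x + ε • t) j ∈ Set.Icc (0 : ℝ) 1 := by
    intro j t hj
    have hcont : Continuous fun ε : ℝ => (x + ε • t) j := by fun_prop
    have h1 : (fun ε : ℝ => (x + ε • t) j) 0 ∈ Set.Ioo (0 : ℝ) 1 := by simpa using hj
    filter_upwards [hcont.continuousAt.eventually_mem (isOpen_Ioo.mem_nhds h1)] with ε hε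
    exact Set.Ioo_subset_Icc_self hε
  have ht : (EuclideanSpace.single m 1 : Plane) ≠ 0 := by simp
  have htR : ∀ᶠ ε in nhds (0 : ℝ), x + ε • (EuclideanSpace.single m 1 : Plane) ∈ unitSquare := by
    filter_upwards [hev m (EuclideanSpace.single m 1) hmI] with ε hε i
    rcases hor i with rfl | rfl
    · exact hε
    · simpa [hne] using hxR (m + 1)
  obtain ⟨i, hi, hit⟩ := hx.exists_inner_ne_zero hc ht htR
  by_cases hb : x (m + 1) = 0 ∨ x (m + 1) = 1
  · obtain ⟨b, hb⟩ : ∃ b, x (m + 1) = bit b := by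
      rcases hb with hb | hb
      · exact ⟨false, by simp [bit, hb]⟩
      · exact ⟨true, by simp [bit, hb]⟩
    obtain ⟨s, hs⟩ : ∃ s, x = sideCrossing r m (bit b) (sgn s) (c i) := by
      rw [← hb]
      rcases eq_sideCrossing m hi with h | h
      · exact ⟨true, h⟩
      · exact ⟨false, h⟩
    refine ⟨.inr (.inl ((m, b, s), i)), ⟨?_, ?_⟩, hs.symm⟩
    · have h1 := dist_sq_plane' m x (c i)
      rw [hi, hb] at h1
      refine abs_le_of_sq_le_sq ?_ hr.le
      nlinarith [sq_nonneg (x m - c i m)]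
    · have h1 : x m = c i m + sgn s * √(r ^ 2 - (bit b - c i (m + 1)) ^ 2) := by
        conv_lhs => rw [hs]
        simp [sideCrossing]
      rw [← h1]
      exact hxR m
  · push Not at hb
    have hmI' : x (m + 1) ∈ Set.Ioo (0 : ℝ) 1 :=
      ⟨lt_of_le_of_ne (hxR _).1 hb.1.symm, lt_of_le_of_ne (hxR _).2 hb.2⟩
    have htR' : ∀ t : Plane, ∀ᶠ ε in nhds (0 : ℝ), x + ε • t ∈ unitSquare := by
      intro t
      filter_upwards [hev m t hmI, hev (m + 1) t hmI'] with ε h1 h2 j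
      rcases hor j with rfl | rfl
      · exact h1
      · exact h2
    have hxi : x - c i ≠ 0 := fun h0 => hit (by rw [h0, inner_zero_left])
    -- The direction tangent to the circle about `c i`: a circle through `x` not tangent to it must
    -- have another centre.
    have hJ : (!₂[-(x 1 - c i 1), x 0 - c i 0] : Plane) ≠ 0 := by
      intro h0
      have h1 := congrArg (fun v : Plane => v 0) h0
      have h2 := congrArg (fun v : Plane => v 1) h0
      simp at h1 h2
      exact hxi (plane_ext (by simpa using h2) (by simp; linarith))
    obtain ⟨j, hj, hjt⟩ := hx.exists_inner_ne_zero hc hJ (htR' _)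
    have hij : c i ≠ c j := by
      intro hij
      apply hjt
      rw [inner_plane, ← hij]
      simp; ring
    have hd : dist (c i) (c j) ≤ 2 * r := by
      have := dist_triangle_left (c i) (c j) x
      linarith
    rcases eq_crossing_or_eq_crossing hij hi hj with h | h
    · exact ⟨.inr (.inr (i, j)), ⟨hij, hd, by rw [← h]; exact hxR⟩, h.symm⟩
    · exact ⟨.inr (.inr (j, i)), ⟨hij.symm, by rw [dist_comm]; exact hd, by rw [← h]; exact hxR⟩,
        h.symm⟩

/-- If the vacant region has positive area, it has a vertex different from two given points. -/
lemma exists_vertex_ne {c : ℕ → Plane} {r : ℝ} {k : ℕ} (hr : 0 < r)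
    (hc : ∀ x ρ, {i | dist x (c i) ≤ ρ}.Finite) (hU : volume (vacant c r k) ≠ 0) (a b : Plane) :
    ∃ v : Vertex, (v.Exists c r ∧ Set.encard {i | c i ∈ Metric.ball (v.loc c r) r} < k) ∧
      v.loc c r ≠ a ∧ v.loc c r ≠ b := by
  have hK : IsCompact (closure (vacant c r k)) :=
    (isBounded_unitSquare.subset fun x hx => hx.1).isCompact_closure
  obtain ⟨x, hx, hxa, hxb⟩ := exists_isFarthest_ne hK subset_closure hU a b
  obtain ⟨v, hv, rfl⟩ := hx.exists_vertex hr (hc x)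
  exact ⟨v, ⟨hv, encard_lt_of_mem_closure_vacant hx.1⟩, hxa, hxb⟩

/-! ### Areas of the sets of centres that generate crossings -/

section Areas

lemma measurePreserving_plane (m : Fin 2) :
    MeasurePreserving (fun x : Plane => (x m, x (m + 1))) volume (volume.prod volume) := by
  have h := (volume_preserving_finTwoArrow ℝ).comp (EuclideanSpace.volume_preserving_symm_measurableEquiv_toLp (Fin 2))
  fin_cases m
  · exact h
  · exact Measure.measurePreserving_swap.comp h

lemma volume_unitSquare : volume unitSquare = 1 := by
  have h : unitSquare = (fun x : Plane => (x 0, x (0 + 1))) ⁻¹' (Set.Icc 0 1 ×ˢ Set.Icc 0 1) := by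
    ext x
    simp only [unitSquare, Fin.forall_fin_two]
    rfl
  rw [h, (measurePreserving_plane 0).measure_preimage
    (measurableSet_Icc.prod measurableSet_Icc).nullMeasurableSet, Measure.prod_prod]
  simp

lemma measurableSet_sideSet (r : ℝ) (t : Fin 2 × Bool × Bool) : MeasurableSet (sideSet r t) := by
  refine IsClosed.measurableSet (IsClosed.inter ?_ ?_)
  · exact isClosed_le (f := fun c : Plane => |bit t.2.1 - c (t.1 + 1)|) (by fun_prop)
      continuous_const
  · exact isClosed_Icc.preimage (f := fun c : Plane => c t.1 + sgn t.2.2 *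
      √(r ^ 2 - (bit t.2.1 - c (t.1 + 1)) ^ 2)) (by fun_prop)

/-- Once the coordinate across the side is fixed within `r` of it, the other coordinate ranges over
a translate of the unit interval; the first ranges over length `2 * r`. -/
lemma volume_sideSet {r : ℝ} (t : Fin 2 × Bool × Bool) :
    volume (sideSet r t) = ENNReal.ofReal (2 * r) := by
  obtain ⟨m, b, s⟩ := t
  let T : Set (ℝ × ℝ) := {p | |bit b - p.2| ≤ r ∧
    p.1 + sgn s * √(r ^ 2 - (bit b - p.2) ^ 2) ∈ Set.Icc (0 : ℝ) 1}
  have hT : MeasurableSet T := by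
    refine IsClosed.measurableSet (IsClosed.inter ?_ ?_)
    · exact isClosed_le (f := fun p : ℝ × ℝ => |bit b - p.2|) (by fun_prop) continuous_const
    · exact isClosed_Icc.preimage (f := fun p : ℝ × ℝ => p.1 + sgn s *
        √(r ^ 2 - (bit b - p.2) ^ 2)) (by fun_prop)
  have h : sideSet r (m, b, s) = (fun x : Plane => (x m, x (m + 1))) ⁻¹' T := rfl
  rw [h, (measurePreserving_plane m).measure_preimage hT.nullMeasurableSet,
    Measure.prod_apply_symm hT]
  have h2 : ∀ y, volume ((fun x : ℝ => (x, y)) ⁻¹' T) =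
      (Set.Icc (bit b - r) (bit b + r)).indicator 1 y := by
    intro y
    by_cases hy : |bit b - y| ≤ r
    · have h3 : (fun x : ℝ => (x, y)) ⁻¹' T =
          (fun x => x + sgn s * √(r ^ 2 - (bit b - y) ^ 2)) ⁻¹' Set.Icc 0 1 := by
        ext x
        simp only [T, hy, true_and, Set.preimage_ofPred_eq, Set.mem_ofPred_eq, Set.mem_preimage]
      have h4 : y ∈ Set.Icc (bit b - r) (bit b + r) := by
        rw [abs_le] at hy
        constructor <;> linarith
      rw [h3, measure_preimage_add_right, Set.indicator_of_mem h4]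
      simp
    · have h3 : (fun x : ℝ => (x, y)) ⁻¹' T = ∅ := by
        ext x
        simp [T, hy]
      have h4 : y ∉ Set.Icc (bit b - r) (bit b + r) := by
        intro h5
        apply hy
        rw [abs_le]
        constructor <;> linarith [h5.1, h5.2]
      rw [h3, Set.indicator_of_notMem h4, measure_empty]
  simp_rw [h2]
  rw [lintegral_indicator_one measurableSet_Icc, Real.volume_Icc]
  congr 1; ring

lemma measurable_crossing (r : ℝ) : Measurable (crossing r) := by
  unfold crossing
  refine (WithLp.measurable_toLp 2 (Fin 2 → ℝ)).comp (measurable_pi_iff.2 fun i => ?_)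
  fin_cases i <;> simp <;> fun_prop

lemma measurable_sideCrossing (r : ℝ) (m : Fin 2) (b s : ℝ) : Measurable (sideCrossing r m b s) := by
  unfold sideCrossing
  refine (WithLp.measurable_toLp 2 (Fin 2 → ℝ)).comp (measurable_pi_iff.2 fun i => ?_)
  by_cases h : i = m <;> simp only [h, if_true, if_false] <;> fun_prop

lemma measurableSet_crossingSet (r : ℝ) : MeasurableSet (crossingSet r) := by
  refine MeasurableSet.inter ?_ (MeasurableSet.inter ?_ ?_)
  · exact (measurableSet_eq_fun measurable_fst measurable_snd).compl
  · exact measurableSet_le (measurable_fst.dist measurable_snd) measurable_const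
  · exact measurable_crossing r isClosed_unitSquare.measurableSet

/-- The crossing is translation equivariant. For a fixed difference `v` of the centres, in the disc
of radius `2 * r`, the first centre therefore lies in a translate of the unit square; the disc has
area `4πr²`. -/
lemma volume_crossingSet_le {r : ℝ} (hr : 0 ≤ r) :
    (volume.prod volume) (crossingSet r) ≤ ENNReal.ofReal (4 * Real.pi * r ^ 2) := by
  have hS := measurableSet_crossingSet r
  have hmp := measurePreserving_prod_add (volume : Measure Plane) (volume : Measure Plane)
  rw [← hmp.measure_preimage hS.nullMeasurableSet, Measure.prod_apply_symm (hmp.measurable hS)]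
  calc _ ≤ ∫⁻ v : Plane, (Metric.closedBall (0 : Plane) (2 * r)).indicator 1 v := by
        refine lintegral_mono fun v => ?_
        by_cases hv : v ∈ Metric.closedBall (0 : Plane) (2 * r)
        · rw [Set.indicator_of_mem hv]
          have h1 : (fun x : Plane => (x, v)) ⁻¹' ((fun z : Plane × Plane => (z.1, z.1 + z.2)) ⁻¹'
              crossingSet r) ⊆ (fun x => x + crossing r (0, v)) ⁻¹' unitSquare := by
            rintro x ⟨-, -, hx⟩
            have : crossing r (x, x + v) = x + crossing r (0, v) := by
              refine plane_ext ?_ ?_ <;> simp [crossing] <;> ring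
            rw [Set.mem_preimage, ← this]
            exact hx
          refine (measure_mono h1).trans ?_
          rw [measure_preimage_add_right, volume_unitSquare]
          rfl
        · rw [Set.indicator_of_notMem hv]
          have h1 : (fun x : Plane => (x, v)) ⁻¹' ((fun z : Plane × Plane => (z.1, z.1 + z.2)) ⁻¹'
              crossingSet r) = ∅ := by
            refine Set.eq_empty_of_forall_notMem ?_
            rintro x ⟨-, hx, -⟩
            apply hv
            simpa using hx
          rw [h1, measure_empty]
    _ = _ := by
        rw [lintegral_indicator_one Metric.isClosed_closedBall.measurableSet,
          EuclideanSpace.volume_closedBall_fin_two, ← ENNReal.ofReal_pow (by positivity),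
          ← ENNReal.ofReal_mul (by positivity)]
        congr 1; ring

end Areas

end KCoverage

/-! ### The upper bound -/

namespace KCoverage

open scoped ENNReal

lemma volume_vacant_ne_zero_of_vacancy_pos {Ω : Type*} {X : ℕ → Ω → Plane} {r : ℝ} {k : ℕ} {ω : Ω}
    (h : 0 < vacancy X r unitSquare k ω) : volume (vacant (fun i => X i ω) r k) ≠ 0 := by
  intro h0
  refine h.ne' (Finset.sum_eq_zero fun m hm => ?_)
  refine integral_eq_zero_of_ae ?_
  rw [Filter.EventuallyEq, ae_restrict_iff' isClosed_unitSquare.measurableSet]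
  filter_upwards [measure_eq_zero_iff_ae_notMem.1 h0] with x hx hxR
  have h1 : ¬ Set.encard {i : ℕ | x ∈ Metric.closedBall (X i ω) r} = m := by
    intro h1
    refine hx ⟨hxR, ?_⟩
    rw [h1]
    exact_mod_cast Finset.mem_range.1 hm
  simp only [chi, h1, if_false, Pi.zero_apply]

variable {Ω : Type*} {X : ℕ → Ω → Plane}

/-- The event that a vertex exists and is covered by fewer than `k` of the open discs. -/
def vertexEvent (X : ℕ → Ω → Plane) (r : ℝ) (k : ℕ) (v : Vertex) : Set Ω :=
  {ω | v.Exists (fun i => X i ω) r ∧ count X (Metric.ball (v.loc (fun i => X i ω) r) r) ω < k}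

/-- Vertices are chosen one at a time, each avoiding the locations of its predecessors; distinct
locations force distinct labels. -/
lemma three_le_tsum_vertexEvent {r : ℝ} {k : ℕ} (hr : 0 < r) {ω : Ω}
    (hc : ∀ x ρ, {i | dist x (X i ω) ≤ ρ}.Finite) (h : 0 < vacancy X r unitSquare k ω) :
    3 ≤ ∑' v, (vertexEvent X r k v).indicator (1 : Ω → ℝ≥0∞) ω := by
  have key := exists_vertex_ne hr hc (volume_vacant_ne_zero_of_vacancy_pos h)
  set loc := fun v : Vertex => v.loc (fun i => X i ω) r
  obtain ⟨v₁, h₁, -, -⟩ := key 0 0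
  obtain ⟨v₂, h₂, h₂₁, -⟩ := key (loc v₁) (loc v₁)
  obtain ⟨v₃, h₃, h₃₁, h₃₂⟩ := key (loc v₁) (loc v₂)
  have n₁ : v₁ ∉ ({v₂, v₃} : Finset Vertex) := by
    simp only [Finset.mem_insert, Finset.mem_singleton, not_or]
    exact ⟨fun h => h₂₁ (congrArg loc h.symm), fun h => h₃₁ (congrArg loc h.symm)⟩
  have n₂ : v₂ ∉ ({v₃} : Finset Vertex) := by
    simp only [Finset.mem_singleton]
    exact fun h => h₃₂ (congrArg loc h.symm)
  refine le_trans (le_of_eq ?_) (ENNReal.sum_le_tsum ({v₁, v₂, v₃} : Finset Vertex))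
  rw [Finset.sum_insert n₁, Finset.sum_insert n₂, Finset.sum_singleton,
    Set.indicator_of_mem (show ω ∈ vertexEvent X r k v₁ from h₁),
    Set.indicator_of_mem (show ω ∈ vertexEvent X r k v₂ from h₂),
    Set.indicator_of_mem (show ω ∈ vertexEvent X r k v₃ from h₃)]
  norm_num

variable [MeasurableSpace Ω] {μ : Measure Ω} {lam : ℝ}

lemma IsPoissonProcess.measurableSet_vertexEvent (hX : IsPoissonProcess μ lam X) (r : ℝ) (k : ℕ)
    (v : Vertex) : MeasurableSet (vertexEvent X r k v) := by
  have hl : Measurable fun ω => v.loc (fun i => X i ω) r := by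
    rcases v with v | ⟨t, i⟩ | p
    · exact measurable_const
    · exact (measurable_sideCrossing r _ _ _).comp (hX.measurable i)
    · exact (measurable_crossing r).comp ((hX.measurable _).prodMk (hX.measurable _))
  have he : MeasurableSet {ω | v.Exists (fun i => X i ω) r} := by
    rcases v with v | ⟨t, i⟩ | p
    · exact MeasurableSet.univ
    · exact hX.measurable i (measurableSet_sideSet r t)
    · exact ((hX.measurable p.1).prodMk (hX.measurable p.2)) (measurableSet_crossingSet r)
  refine he.inter ?_
  have := measurable_count_param (S := fun i => {ω | X i ω ∈ Metric.ball
    (v.loc (fun i => X i ω) r) r}) fun i => measurableSet_lt ((hX.measurable i).dist hl)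
      measurable_const
  exact this (Set.to_countable (Set.Iio (k : ℕ∞))).measurableSet

lemma tsum_sum_ennreal {α β : Type*} (f : α ⊕ β → ℝ≥0∞) :
    ∑' v, f v = ∑' a, f (.inl a) + ∑' b, f (.inr b) :=
  ENNReal.summable.tsum_sum ENNReal.summable

variable [IsProbabilityMeasure μ]

/-- The 4 counts corners. The 16 is eight families (direction, side, sign) of area `2 * r` each. The
last coefficient comes from ordered pairs, whose two orders account for the two crossings of a pair
of circles. -/
lemma IsPoissonProcess.tsum_measure_vertexEvent_le (hX : IsPoissonProcess μ lam X)
    (hlam : 0 ≤ lam) {r : ℝ} (hr : 0 < r) (k : ℕ) :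
    ∑' v, μ (vertexEvent X r k v) ≤ ENNReal.ofReal
      ((4 + 16 * lam * r + 4 * Real.pi * r ^ 2 * lam ^ 2) *
        poissonBelow k (lam * (Real.pi * r ^ 2))) := by
  set P := poissonBelow k (lam * (Real.pi * r ^ 2)) with hP
  have hP0 : 0 ≤ P := poissonBelow_nonneg _ (by positivity)
  have h1 : ∑' v : Fin 2 → Bool, μ (vertexEvent X r k (.inl v)) ≤ ENNReal.ofReal (4 * P) := by
    have h : ∀ v : Fin 2 → Bool, μ (vertexEvent X r k (.inl v)) = ENNReal.ofReal P := by
      intro v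
      rw [hP, ← volumeReal_ball_plane (corner v) hr.le,
        ← hX.measure_count_lt hlam Metric.isOpen_ball.measurableSet measure_ball_lt_top.ne]
      congr 1
      ext ω
      simp [vertexEvent, Vertex.Exists, Vertex.loc]
    simp_rw [h]
    rw [tsum_fintype, Finset.sum_const, nsmul_eq_mul, ENNReal.ofReal_mul (by norm_num)]
    simp
  have h2 : ∑' v : (Fin 2 × Bool × Bool) × ℕ, μ (vertexEvent X r k (.inr (.inl v))) ≤
      ENNReal.ofReal (16 * lam * r * P) := by
    have h : ∀ t : Fin 2 × Bool × Bool, ∑' i, μ (vertexEvent X r k (.inr (.inl (t, i)))) ≤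
        ENNReal.ofReal (2 * lam * r * P) := by
      intro t
      refine (hX.tsum_measure_location_le hlam (measurableSet_sideSet r t)
        (by rw [volume_sideSet]; exact ENNReal.ofReal_ne_top)
        (measurable_sideCrossing r t.1 (bit t.2.1) (sgn t.2.2)) k hr).trans ?_
      rw [volume_sideSet, ← ENNReal.ofReal_mul hlam, ← ENNReal.ofReal_mul (by positivity)]
      refine ENNReal.ofReal_le_ofReal (le_of_eq ?_)
      rw [hP]; ring
    rw [ENNReal.tsum_prod']
    refine (ENNReal.tsum_le_tsum h).trans ?_
    rw [tsum_fintype, Finset.sum_const, nsmul_eq_mul, ← ENNReal.ofReal_natCast,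
      ← ENNReal.ofReal_mul (by positivity)]
    refine ENNReal.ofReal_le_ofReal (le_of_eq ?_)
    simp
    ring
  have h3 : ∑' p : ℕ × ℕ, μ (vertexEvent X r k (.inr (.inr p))) ≤
      ENNReal.ofReal (4 * Real.pi * r ^ 2 * lam ^ 2 * P) := by
    have hv := volume_crossingSet_le hr.le
    refine (hX.tsum_measure_pair_location_le hlam (measurableSet_crossingSet r)
      (ne_top_of_le_ne_top ENNReal.ofReal_ne_top hv) (fun p hp => hp.1)
      (measurable_crossing r) k hr).trans ?_
    refine (mul_le_mul_left (mul_le_mul_right hv _) _).trans ?_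
    rw [← ENNReal.ofReal_pow hlam, ← ENNReal.ofReal_mul (by positivity),
      ← ENNReal.ofReal_mul (by positivity)]
    refine ENNReal.ofReal_le_ofReal (le_of_eq ?_)
    rw [hP]; ring
  rw [tsum_sum_ennreal, tsum_sum_ennreal]
  refine (add_le_add h1 (add_le_add h2 h3)).trans ?_
  rw [← ENNReal.ofReal_add (by positivity) (by positivity),
    ← ENNReal.ofReal_add (by positivity) (by positivity)]
  refine ENNReal.ofReal_le_ofReal (le_of_eq ?_)
  ring

lemma IsPoissonProcess.ae_locally_finite (hX : IsPoissonProcess μ lam X) :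
    ∀ᵐ ω ∂μ, ∀ x ρ, {i | dist x (X i ω) ≤ ρ}.Finite := by
  have h : ∀ᵐ ω ∂μ, ∀ n : ℕ, count X (Metric.closedBall 0 n) ω < ⊤ :=
    ae_all_iff.2 fun n => hX.ae_count_lt_top Metric.isClosed_closedBall.measurableSet
      measure_closedBall_lt_top.ne
  filter_upwards [h] with ω hω x ρ
  obtain ⟨n, hn⟩ := exists_nat_ge (dist x 0 + ρ)
  refine (Set.encard_lt_top_iff.1 (hω n)).subset fun i hi => ?_
  have hi' : dist x (X i ω) ≤ ρ := hi
  refine Metric.mem_closedBall.2 ?_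
  linarith [dist_triangle_left (X i ω) 0 x]

/-- Markov's inequality at level 3 for the number of vacant vertices. -/
lemma IsPoissonProcess.measureReal_vacancy_pos_le (hX : IsPoissonProcess μ lam X)
    (hlam : 0 ≤ lam) {r : ℝ} (hr : 0 < r) (k : ℕ) :
    3 * μ.real {ω | 0 < vacancy X r unitSquare k ω} ≤
      (4 + 16 * lam * r + 4 * Real.pi * r ^ 2 * lam ^ 2) *
        poissonBelow k (lam * (Real.pi * r ^ 2)) := by
  have hnn : 0 ≤ poissonBelow k (lam * (Real.pi * r ^ 2)) := poissonBelow_nonneg _ (by positivity)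
  have hm : ∀ v, Measurable ((vertexEvent X r k v).indicator (1 : Ω → ℝ≥0∞)) := fun v =>
    measurable_one.indicator (hX.measurableSet_vertexEvent r k v)
  have h1 : 3 * μ {ω | 0 < vacancy X r unitSquare k ω} ≤ ∑' v, μ (vertexEvent X r k v) := by
    calc 3 * μ {ω | 0 < vacancy X r unitSquare k ω}
        ≤ 3 * μ {ω | 3 ≤ ∑' v, (vertexEvent X r k v).indicator (1 : Ω → ℝ≥0∞) ω} := by
          refine mul_le_mul_right (measure_mono_ae ?_) _
          filter_upwards [hX.ae_locally_finite] with ω hω h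
          exact three_le_tsum_vertexEvent hr hω h
      _ ≤ ∫⁻ ω, ∑' v, (vertexEvent X r k v).indicator (1 : Ω → ℝ≥0∞) ω ∂μ :=
          mul_meas_ge_le_lintegral (Measurable.tsum hm) 3
      _ = ∑' v, μ (vertexEvent X r k v) := by
          rw [lintegral_tsum fun v => (hm v).aemeasurable]
          exact tsum_congr fun v => lintegral_indicator_one (hX.measurableSet_vertexEvent r k v)
  have h2 := ENNReal.toReal_mono ENNReal.ofReal_ne_top
    (h1.trans (hX.tsum_measure_vertexEvent_le hlam hr k))
  rw [ENNReal.toReal_mul, ENNReal.toReal_ofReal (by positivity)] at h2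
  exact_mod_cast h2

/-- Comparison of the vertex count with the closed form. -/
lemma min_vertex_bound_le {lam r p : ℝ} (hlam : 0 < lam) (hr : 0 < r)
    (hr1 : Real.pi * r ^ 2 ≤ 1) (hp : Real.exp (-(lam * Real.pi * r ^ 2)) ≤ p) :
    min 1 ((4 + 16 * lam * r + 4 * Real.pi * r ^ 2 * lam ^ 2) * p / 3) ≤
      2 * Real.exp (-(lam * Real.pi * r ^ 2)) +
        2 * (lam ^ 2 * Real.pi * r ^ 2 + 2 * lam * r) * p := by
  have hpi := Real.pi_gt_d2
  have hpi' := Real.pi_lt_d2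
  set a := lam * Real.pi * r ^ 2 with ha
  set e := Real.exp (-a) with he
  have he0 : 0 < e := Real.exp_pos _
  have ha0 : 0 < a := by positivity
  have hr2 : r < 0.565 := by
    by_contra! h
    nlinarith
  have hlama : a ≤ lam := by rw [ha]; nlinarith
  have hlama2 : lam ^ 2 * Real.pi * r ^ 2 = lam * a := by rw [ha]; ring
  have hpir : Real.pi * r ≤ 1.78 := by nlinarith
  have hlr : a ≤ 1.78 * (lam * r) := by
    have : a = (lam * r) * (Real.pi * r) := by rw [ha]; ring
    rw [this]
    nlinarith [mul_pos hlam hr]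
  rw [hlama2]
  -- For large `a` the vertex count suffices: the comparison of the coefficients of `p` reduces to
  -- `2λr + 2 ≤ λa`. For small `a` the right side already exceeds 1.
  rcases le_or_gt 2.2 a with h | h
  · refine (min_le_right _ _).trans ?_
    have h1 : 2 * (lam * r) + 2 ≤ lam * a := by nlinarith
    have h2 : Real.pi * r ^ 2 * lam ^ 2 = lam * a := by rw [← hlama2]; ring
    have h3 : (4 + 16 * lam * r + 4 * Real.pi * r ^ 2 * lam ^ 2) =
        4 + 16 * (lam * r) + 4 * (lam * a) := by linear_combination 4 * h2
    rw [h3]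
    nlinarith
  · refine (min_le_left _ _).trans ?_
    -- Dividing by 3 brings the argument below 1, where the quadratic estimate of the exponential is
    -- valid; the result is then cubed.
    have hx : Real.exp (a / 3) ≤ 1 + a / 3 + (a / 3) ^ 2 := by
      have := Real.abs_exp_sub_one_sub_id_le (x := a / 3) (by rw [abs_le]; constructor <;> linarith)
      linarith [(abs_le.1 this).2]
    have hexp : Real.exp a ≤ 2 + 2 * a ^ 2 + 2.24 * a := by
      have h1 : Real.exp a = Real.exp (a / 3) ^ 3 := by
        rw [← Real.exp_nat_mul]; congr 1; push_cast; ring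
      rw [h1]
      refine (pow_le_pow_left₀ (Real.exp_pos _).le hx 3).trans ?_
      obtain ⟨x, hx⟩ : ∃ x, x = a / 3 := ⟨_, rfl⟩
      have hax : a = 3 * x := by rw [hx]; ring
      have hx0 : 0 < x := by rw [hx]; positivity
      have hx1 : x < 0.734 := by rw [hx]; linarith
      rw [← hx, hax]
      have b1 : x ^ 3 ≤ 0.734 * x ^ 2 := by nlinarith [sq_nonneg x]
      have b2 : x ^ 4 ≤ 0.54 * x ^ 2 := by nlinarith [sq_nonneg x]
      have b3 : x ^ 5 ≤ 0.4 * x ^ 2 := by nlinarith [sq_nonneg x, pow_pos hx0 3]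
      have b4 : x ^ 6 ≤ 0.3 * x ^ 2 := by nlinarith [sq_nonneg x, pow_pos hx0 4]
      nlinarith [sq_nonneg x]
    have hee : e * Real.exp a = 1 := by rw [he, ← Real.exp_add]; simp
    have h2 : 1 ≤ e * (2 + 2 * a ^ 2 + 2.24 * a) := by
      rw [← hee]; exact mul_le_mul_of_nonneg_left hexp he0.le
    have h3 : 2 * (lam * a + 2 * lam * r) * p ≥ (2 * a ^ 2 + 2.24 * a) * e := by
      have h4 : 2 * a ^ 2 + 2.24 * a ≤ 2 * (lam * a + 2 * lam * r) := by nlinarith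
      exact mul_le_mul h4 hp he0.le (by positivity)
    linarith

lemma IsPoissonProcess.measureReal_vacancy_pos_le_closed_form (hX : IsPoissonProcess μ lam X)
    (hlam : 0 < lam) {r : ℝ} (hr : 0 < r) (hr1 : Real.pi * r ^ 2 ≤ 1) {k : ℕ} (hk : 1 ≤ k) :
    μ.real {ω | 0 < vacancy X r unitSquare k ω} ≤
      2 * Real.exp (-(lam * Real.pi * r ^ 2)) *
        (1 + lam ^ 2 * Real.pi * r ^ 2 * (1 + 2 / (lam * Real.pi * r)) *
          ∑ i ∈ Finset.range k, (lam * Real.pi * r ^ 2) ^ i / (i ! : ℝ)) := by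
  have h1 := hX.measureReal_vacancy_pos_le hlam.le hr k
  have h0 : μ.real {ω | 0 < vacancy X r unitSquare k ω} ≤ 1 := measureReal_le_one
  -- As `k ≥ 1`, the term `i = 0` is present, which gives `e^{-a} ≤ P`.
  have hS : 1 ≤ ∑ i ∈ Finset.range k, (lam * Real.pi * r ^ 2) ^ i / (i ! : ℝ) := by
    have := Finset.single_le_sum (f := fun i : ℕ => (lam * Real.pi * r ^ 2) ^ i / (i ! : ℝ))
      (s := Finset.range k) (fun i _ => by have := Real.pi_pos; positivity)
      (Finset.mem_range.2 (Nat.lt_of_lt_of_le Nat.zero_lt_one hk))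
    simpa using this
  have e1 : lam * (Real.pi * r ^ 2) = lam * Real.pi * r ^ 2 := by ring
  rw [e1] at h1
  have h2 := min_vertex_bound_le (p := poissonBelow k (lam * Real.pi * r ^ 2)) hlam hr hr1 (by
    unfold poissonBelow
    exact le_mul_of_one_le_right (Real.exp_pos _).le hS)
  refine (le_min h0 (by linarith)).trans (h2.trans (le_of_eq ?_))
  unfold poissonBelow
  have := Real.pi_pos
  field_simp

end KCoverage

/-! ### Area of a lune -/

namespace KCoverage

open scoped ENNReal

section Lune

/-- The part of the disc at the origin outside a disc shifted along the first axis. -/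
lemma volume_lune_axis_ge {r s : ℝ} (hr : 0 < r) (hs0 : 0 ≤ s) (hs : s ≤ 2 * r) :
    ENNReal.ofReal (s / (2 * r)) * volume (Metric.closedBall (0 : Plane) r) ≤
      volume (Metric.closedBall (0 : Plane) r \
        Metric.closedBall (EuclideanSpace.single 0 s : Plane) r) := by
  let T₁ : Set (ℝ × ℝ) := {p | p.1 ^ 2 + p.2 ^ 2 ≤ r ^ 2}
  let T₂ : Set (ℝ × ℝ) := {p | p.1 ^ 2 + p.2 ^ 2 ≤ r ^ 2 ∧ r ^ 2 < (p.1 - s) ^ 2 + p.2 ^ 2}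
  have hT₁ : MeasurableSet T₁ :=
    measurableSet_le (f := fun p : ℝ × ℝ => p.1 ^ 2 + p.2 ^ 2) (by fun_prop) measurable_const
  have hT₂ : MeasurableSet T₂ := hT₁.inter
    (measurableSet_lt (g := fun p : ℝ × ℝ => (p.1 - s) ^ 2 + p.2 ^ 2) measurable_const
      (by fun_prop))
  have hmem : ∀ x y : Plane, dist x y ≤ r ↔ (x 0 - y 0) ^ 2 + (x 1 - y 1) ^ 2 ≤ r ^ 2 := by
    intro x y
    rw [← dist_sq_plane]
    exact (pow_le_pow_iff_left₀ dist_nonneg hr.le two_ne_zero).symm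
  have h₁ : Metric.closedBall (0 : Plane) r = (fun x : Plane => (x 0, x (0 + 1))) ⁻¹' T₁ := by
    ext x
    rw [Metric.mem_closedBall, hmem]
    simp [T₁]
  have h₂ : Metric.closedBall (0 : Plane) r \
      Metric.closedBall (EuclideanSpace.single 0 s : Plane) r =
      (fun x : Plane => (x 0, x (0 + 1))) ⁻¹' T₂ := by
    ext x
    rw [Set.mem_sdiff, Metric.mem_closedBall, Metric.mem_closedBall, hmem, hmem]
    simp [T₂]
  have hmp := measurePreserving_plane 0
  rw [h₂, h₁, hmp.measure_preimage hT₁.nullMeasurableSet, hmp.measure_preimage hT₂.nullMeasurableSet,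
    Measure.prod_apply_symm hT₁, Measure.prod_apply_symm hT₂,
    ← lintegral_const_mul' _ _ ENNReal.ofReal_ne_top]
  refine lintegral_mono fun h => ?_
  -- At height `h` the disc is a chord of half-length `l`, and its leftmost piece of length up to
  -- `s` escapes the shifted disc. Since `l ≤ r`, this contains at least the fraction `s / (2 * r)`
  -- of the chord.
  set l := √(r ^ 2 - h ^ 2) with hl
  by_cases hh : h ^ 2 ≤ r ^ 2
  · have hl0 : 0 ≤ l := Real.sqrt_nonneg _
    have hlsq : l ^ 2 = r ^ 2 - h ^ 2 := Real.sq_sqrt (by linarith)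
    have hlr : l ≤ r := by
      refine le_of_sq_le_sq ?_ hr.le
      nlinarith [sq_nonneg h]
    have e₁ : (fun u : ℝ => (u, h)) ⁻¹' T₁ ⊆ Set.Icc (-l) l := by
      intro u hu
      have hu' : u ^ 2 + h ^ 2 ≤ r ^ 2 := hu
      rw [Set.mem_Icc, ← abs_le]
      exact abs_le_of_sq_le_sq (by linarith) hl0
    have ht1 : s / (2 * r) ≤ 1 := by rw [div_le_one (by positivity)]; exact hs
    have ht0 : 0 ≤ s / (2 * r) := by positivity
    have hts : s / (2 * r) * (2 * l) ≤ s := by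
      rw [div_mul_eq_mul_div, div_le_iff₀ (by positivity)]
      nlinarith
    -- The interval is half-open because escaping the closed shifted disc is a strict inequality.
    have e₂ : Set.Ico (-l) (-l + s / (2 * r) * (2 * l)) ⊆ (fun u : ℝ => (u, h)) ⁻¹' T₂ := by
      rintro u ⟨hu1, hu2⟩
      refine ⟨?_, ?_⟩
      · have : u ≤ l := by nlinarith
        show u ^ 2 + h ^ 2 ≤ r ^ 2
        nlinarith
      · have : l < s - u := by linarith
        show r ^ 2 < (u - s) ^ 2 + h ^ 2
        nlinarith
    calc _ ≤ ENNReal.ofReal (s / (2 * r)) * volume (Set.Icc (-l) l) := by gcongr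
      _ = volume (Set.Ico (-l) (-l + s / (2 * r) * (2 * l))) := by
          rw [Real.volume_Icc, Real.volume_Ico, ← ENNReal.ofReal_mul ht0]
          congr 1; ring
      _ ≤ _ := measure_mono e₂
  · have : (fun u : ℝ => (u, h)) ⁻¹' T₁ = ∅ := by
      refine Set.eq_empty_of_forall_notMem fun u hu => hh ?_
      have hu' : u ^ 2 + h ^ 2 ≤ r ^ 2 := hu
      nlinarith [sq_nonneg u]
    rw [this]
    simp

/-- A translation and a reflection put both centres on the first axis; the fraction `s / (2 * r)` of
`πr²` is `πrs / 2`. -/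
lemma volumeReal_lune_ge {r : ℝ} (hr : 0 < r) (x y : Plane) (hxy : dist x y ≤ 2 * r) :
    Real.pi * r / 2 * dist x y ≤
      volume.real (Metric.closedBall x r \ Metric.closedBall y r) := by
  set s := dist x y with hs
  have hs0 : 0 ≤ s := dist_nonneg
  have hnorm : ‖y - x‖ = ‖(EuclideanSpace.single 0 s : Plane)‖ := by
    rw [PiLp.norm_single, Real.norm_of_nonneg hs0, hs, dist_comm, dist_eq_norm]
  obtain ⟨f, hf⟩ : ∃ f : Plane ≃ₗᵢ[ℝ] Plane, f (y - x) = EuclideanSpace.single 0 s :=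
    ⟨_, Submodule.reflection_sub hnorm⟩
  have hset : Metric.closedBall x r \ Metric.closedBall y r = (fun z => z + -x) ⁻¹' (f ⁻¹'
      (Metric.closedBall (0 : Plane) r \
        Metric.closedBall (EuclideanSpace.single 0 s : Plane) r)) := by
    ext z
    simp only [Set.mem_sdiff, Metric.mem_closedBall, Set.mem_preimage]
    rw [← hf, f.dist_map, dist_zero_right, f.norm_map, dist_eq_norm, dist_eq_norm, dist_eq_norm,
      ← sub_eq_add_neg, sub_sub_sub_cancel_right]
  have hm : MeasurableSet (Metric.closedBall (0 : Plane) r \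
        Metric.closedBall (EuclideanSpace.single 0 s : Plane) r) :=
    Metric.isClosed_closedBall.measurableSet.diff Metric.isClosed_closedBall.measurableSet
  have hv : volume (Metric.closedBall x r \ Metric.closedBall y r) =
      volume (Metric.closedBall (0 : Plane) r \
        Metric.closedBall (EuclideanSpace.single 0 s : Plane) r) := by
    rw [hset, measure_preimage_add_right, f.measurePreserving.measure_preimage hm.nullMeasurableSet]
  have h := ENNReal.toReal_mono (measure_ne_top_of_subset Set.sdiff_subset
    measure_closedBall_lt_top.ne) (volume_lune_axis_ge hr hs0 hxy)
  rw [ENNReal.toReal_mul, ENNReal.toReal_ofReal (by positivity)] at h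
  have h2 := volumeReal_closedBall_plane 0 hr.le
  rw [Measure.real] at h2 ⊢
  rw [hv]
  rw [h2] at h
  refine le_trans (le_of_eq ?_) h
  field_simp

end Lune

/-! ### Integral of the error term over the plane -/

section RadialIntegral

/-- By the Gamma integral, the `i`-th term contributes `(i + 1) / b²`. -/
lemma integral_mul_poissonBelow (k : ℕ) {b : ℝ} (hb : 0 < b) :
    IntegrableOn (fun y : ℝ => y * poissonBelow k (b * y)) (Set.Ioi 0) ∧
      ∫ y in Set.Ioi (0 : ℝ), y * poissonBelow k (b * y) = k * (k + 1) / (2 * b ^ 2) := by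
  have h1 : ∀ i : ℕ, ∫ y in Set.Ioi (0 : ℝ), y ^ (i + 1) * Real.exp (-(b * y)) =
      (i + 1)! / b ^ (i + 2) := by
    intro i
    have h := Real.integral_rpow_mul_exp_neg_mul_Ioi (a := i + 2) (r := b) (by positivity) hb
    have e1 : ((i : ℝ) + 2 - 1) = ((i + 1 : ℕ) : ℝ) := by push_cast; ring
    have e2 : ((i : ℝ) + 2) = ((i + 1 : ℕ) : ℝ) + 1 := by push_cast; ring
    rw [e1] at h
    simp_rw [Real.rpow_natCast] at h
    rw [h, e2, Real.Gamma_nat_eq_factorial]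
    have e3 : ((i + 1 : ℕ) : ℝ) + 1 = ((i + 2 : ℕ) : ℝ) := by push_cast; ring
    rw [e3, Real.rpow_natCast, one_div, inv_pow]
    field_simp
  have h2 : ∀ i : ℕ, IntegrableOn (fun y : ℝ => y ^ (i + 1) * Real.exp (-(b * y)))
      (Set.Ioi 0) := by
    intro i
    -- A Bochner integral defaults to 0 for a non-integrable function, so the nonzero value just
    -- computed proves integrability.
    refine Integrable.of_integral_ne_zero ?_
    rw [h1]; positivity
  have h3 : ∀ y, y * poissonBelow k (b * y) =
      ∑ i ∈ Finset.range k, b ^ i / (i ! : ℝ) * (y ^ (i + 1) * Real.exp (-(b * y))) := by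
    intro y
    unfold poissonBelow
    rw [Finset.mul_sum, Finset.mul_sum]
    refine Finset.sum_congr rfl fun i _ => ?_
    rw [mul_pow]; ring
  simp_rw [h3]
  refine ⟨integrable_finsetSum _ fun i _ => (h2 i).const_mul _, ?_⟩
  rw [integral_finsetSum _ fun i _ => (h2 i).const_mul _]
  have h4 : ∀ i : ℕ, ∫ y in Set.Ioi (0 : ℝ),
      b ^ i / (i ! : ℝ) * (y ^ (i + 1) * Real.exp (-(b * y))) = (i + 1) / b ^ 2 := by
    intro i
    rw [integral_const_mul, h1, Nat.factorial_succ]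
    push_cast
    have : (i ! : ℝ) ≠ 0 := by positivity
    field_simp
    ring
  simp_rw [h4]
  rw [← Finset.sum_div]
  have h5 : ∑ i ∈ Finset.range k, ((i : ℝ) + 1) = k * (k + 1) / 2 := by
    induction k with
    | zero => simp
    | succ k ih => rw [Finset.sum_range_succ, ih (by
        intro y; unfold poissonBelow; rw [Finset.mul_sum, Finset.mul_sum]
        refine Finset.sum_congr rfl fun i _ => ?_
        rw [mul_pow]; ring)]; push_cast; ring
  rw [h5]
  field_simp

lemma lintegral_poissonBelow_dist (k : ℕ) {b : ℝ} (hb : 0 < b) (x : Plane) :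
    ∫⁻ y : Plane, ENNReal.ofReal (poissonBelow k (b * dist x y)) =
      ENNReal.ofReal (Real.pi * k * (k + 1) / b ^ 2) := by
  obtain ⟨h1, h2⟩ := integral_mul_poissonBelow k hb
  have hfr : Module.finrank ℝ Plane = 2 := by simp
  have h3 : Integrable (fun v : Plane => poissonBelow k (b * ‖v‖)) := by
    rw [integrable_fun_norm_addHaar (volume : Measure Plane)
      (f := fun y => poissonBelow k (b * y)), hfr]
    simpa using h1
  have h4 := integral_fun_norm_addHaar (volume : Measure Plane) fun y => poissonBelow k (b * y)
  rw [hfr] at h4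
  have h5 := lintegral_sub_left_eq_self (μ := volume)
    (fun v : Plane => ENNReal.ofReal (poissonBelow k (b * ‖v‖))) x
  simp_rw [dist_eq_norm]
  rw [h5, ← ofReal_integral_eq_lintegral_ofReal h3 (Filter.Eventually.of_forall fun v =>
    poissonBelow_nonneg k (by positivity)), h4, volumeReal_ball_plane 0 zero_le_one]
  simp only [smul_eq_mul, nsmul_eq_mul, Nat.add_one_sub_one, pow_one, h2]
  congr 1
  push_cast
  field_simp

end RadialIntegral

end KCoverage

/-! ### The lower bound by the second moment method -/

namespace KCoverage

open scoped ENNReal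

variable {Ω : Type*} {X : ℕ → Ω → Plane}

/-- The event that `x` is covered by fewer than `k` of the closed discs. -/
def vacantEvent (X : ℕ → Ω → Plane) (r : ℝ) (k : ℕ) (x : Plane) : Set Ω :=
  {ω | Set.encard {i : ℕ | x ∈ Metric.closedBall (X i ω) r} < k}

lemma vacantEvent_eq (r : ℝ) (k : ℕ) (x : Plane) :
    vacantEvent X r k x = {ω | count X (Metric.closedBall x r) ω < k} := by
  ext ω
  simp only [vacantEvent, count, Metric.mem_closedBall, dist_comm x]

lemma vacancy_pos_of_volume_vacant_ne_zero {r : ℝ} {k : ℕ} {ω : Ω}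
    (h : volume (vacant (fun i => X i ω) r k) ≠ 0) : 0 < vacancy X r unitSquare k ω := by
  let E : ℕ → Set Plane := fun m => {x | Set.encard {i : ℕ | x ∈ Metric.closedBall (X i ω) r} = m}
  have hE : ∀ m, MeasurableSet (E m) := fun m =>
    measurable_count_param (S := fun i => Metric.closedBall (X i ω) r)
      (fun i => Metric.isClosed_closedBall.measurableSet) (measurableSet_singleton _)
  have hint : ∀ m, ∫ x in unitSquare, chi X r m x ω = volume.real (E m ∩ unitSquare) := by
    intro m
    have : (fun x => chi X r m x ω) = (E m).indicator 1 := by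
      ext x
      by_cases hx : Set.encard {i : ℕ | x ∈ Metric.closedBall (X i ω) r} = m
      · rw [Set.indicator_of_mem (show x ∈ E m from hx)]
        simp only [chi, hx, if_true, Pi.one_apply]
      · rw [Set.indicator_of_notMem (show x ∉ E m from hx)]
        simp only [chi, hx, if_false]
    rw [this, integral_indicator_one (hE m), measureReal_restrict_apply (hE m)]
  unfold vacancy
  simp_rw [hint]
  refine Finset.sum_pos' (fun m _ => measureReal_nonneg) ?_
  by_contra! hcon
  apply h
  have hsub : vacant (fun i => X i ω) r k ⊆ ⋃ m ∈ Finset.range k, E m ∩ unitSquare := by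
    rintro x ⟨hxR, hx⟩
    obtain ⟨m, hm⟩ := ENat.ne_top_iff_exists.1 hx.ne_top
    rw [← hm] at hx
    exact Set.mem_biUnion (Finset.mem_coe.2 (Finset.mem_range.2 (by exact_mod_cast hx)))
      ⟨hm.symm, hxR⟩
  refine measure_mono_null hsub ((measure_biUnion_null_iff (Finset.countable_toSet _)).2
    fun m hm => ?_)
  have h1 := le_antisymm (hcon m hm) measureReal_nonneg
  refine (measureReal_eq_zero_iff (measure_ne_top_of_subset Set.inter_subset_right ?_)).1 h1
  rw [volume_unitSquare]; exact ENNReal.one_ne_top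

variable [MeasurableSpace Ω] {μ : Measure Ω} {lam : ℝ}

lemma IsPoissonProcess.measure_count_lt_inter (hX : IsPoissonProcess μ lam X) (hlam : 0 ≤ lam)
    {A D : Set Plane} (hA : MeasurableSet A) (hD : MeasurableSet D)
    (hA' : volume A ≠ ⊤) (hD' : volume D ≠ ⊤) (hAD : Disjoint A D) (k : ℕ) :
    μ ({ω | count X A ω < k} ∩ {ω | count X D ω < k}) =
      ENNReal.ofReal (poissonBelow k (lam * volume.real A)) *
        ENNReal.ofReal (poissonBelow k (lam * volume.real D)) := by
  have hind := hX.indep_count 2 ![A, D] (by simp [Fin.forall_fin_two, hA, hD])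
    (by simp [Fin.forall_fin_two, hA', hD'])
    (by intro i j hij; fin_cases i <;> fin_cases j <;> simp_all [hAD.symm])
  have h2 : IndepFun (count X A) (count X D) μ := hind.indepFun (i := 0) (j := 1) (by simp)
  have hm := (Set.to_countable (Set.Iio (k : ℕ∞))).measurableSet
  rw [← hX.measure_count_lt hlam hA hA', ← hX.measure_count_lt hlam hD hD']
  exact h2.measure_inter_preimage_eq_mul _ _ hm hm

lemma IsPoissonProcess.measure_vacantEvent (hX : IsPoissonProcess μ lam X) (hlam : 0 ≤ lam)
    {r : ℝ} (hr : 0 ≤ r) (k : ℕ) (x : Plane) :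
    μ (vacantEvent X r k x) =
      ENNReal.ofReal (poissonBelow k (lam * (Real.pi * r ^ 2))) := by
  rw [vacantEvent_eq, hX.measure_count_lt hlam Metric.isClosed_closedBall.measurableSet
    measure_closedBall_lt_top.ne, volumeReal_closedBall_plane x hr]

/-- Two points are both vacant with probability at most that for independent points plus an error
which is small for distant points. -/
lemma IsPoissonProcess.measure_vacantEvent_inter_le (hX : IsPoissonProcess μ lam X)
    (hlam : 0 ≤ lam) {r : ℝ} (hr : 0 < r) (k : ℕ) (x y : Plane) :
    μ (vacantEvent X r k x ∩ vacantEvent X r k y) ≤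
      ENNReal.ofReal (poissonBelow k (lam * (Real.pi * r ^ 2))) *
        (ENNReal.ofReal (poissonBelow k (lam * (Real.pi * r ^ 2))) +
          ENNReal.ofReal (poissonBelow k (lam * (Real.pi * r / 2) * dist x y))) := by
  have hm : ∀ z : Plane, MeasurableSet (Metric.closedBall z r) := fun z =>
    Metric.isClosed_closedBall.measurableSet
  have ht : ∀ z : Plane, volume (Metric.closedBall z r) ≠ ⊤ := fun z =>
    measure_closedBall_lt_top.ne
  have h := hX.measure_count_lt_inter hlam (hm x) ((hm y).diff (hm x)) (ht x)
    (measure_ne_top_of_subset Set.sdiff_subset (ht y)) Set.disjoint_sdiff_right k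
  -- Discarding the overlap of the two discs only enlarges the event and leaves disjoint, hence
  -- independent, regions.
  have hsub : vacantEvent X r k x ∩ vacantEvent X r k y ⊆
      {ω | count X (Metric.closedBall x r) ω < k} ∩
        {ω | count X (Metric.closedBall y r \ Metric.closedBall x r) ω < k} := by
    rw [vacantEvent_eq, vacantEvent_eq]
    exact fun ω hω => ⟨hω.1, lt_of_le_of_lt (count_mono Set.sdiff_subset ω) hω.2⟩
  refine (measure_mono hsub).trans ?_
  rw [h, volumeReal_closedBall_plane x hr.le]
  gcongr
  -- Overlapping discs are handled by the lune, disjoint ones by exact independence; each case uses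
  -- one summand of the bound.
  rcases le_or_gt (dist x y) (2 * r) with hxy | hxy
  · refine le_add_left (ENNReal.ofReal_le_ofReal (antitoneOn_poissonBelow k ?_ ?_ ?_))
    · rw [Set.mem_Ici]; positivity
    · rw [Set.mem_Ici]; positivity
    · rw [mul_assoc]
      gcongr
      rw [dist_comm] at hxy ⊢
      exact volumeReal_lune_ge hr y x hxy
  · have hd : Metric.closedBall y r \ Metric.closedBall x r = Metric.closedBall y r := by
      refine sdiff_eq_left.2 (Metric.closedBall_disjoint_closedBall ?_)
      rw [dist_comm]; linarith
    rw [hd, volumeReal_closedBall_plane y hr.le]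
    exact le_self_add

lemma IsPoissonProcess.measurableSet_vacant (hX : IsPoissonProcess μ lam X) (r : ℝ) (k : ℕ) :
    MeasurableSet {p : Plane × Ω | Set.encard {i : ℕ | p.1 ∈ Metric.closedBall (X i p.2) r} < k} := by
  have := measurable_count_param
    (S := fun i => {p : Plane × Ω | p.1 ∈ Metric.closedBall (X i p.2) r}) fun i =>
      measurableSet_le (measurable_fst.dist ((hX.measurable i).comp measurable_snd))
        measurable_const
  exact this (Set.to_countable (Set.Iio (k : ℕ∞))).measurableSet

/-- The second moment method. -/
lemma sq_lintegral_le_lintegral_sq_mul {α : Type*} [MeasurableSpace α] {ν : Measure α}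
    {W : α → ℝ≥0∞} (hW : Measurable W) :
    (∫⁻ a, W a ∂ν) ^ 2 ≤ (∫⁻ a, W a ^ 2 ∂ν) * ν {a | W a ≠ 0} := by
  have hS : MeasurableSet {a | W a ≠ 0} := (hW (measurableSet_singleton 0)).compl
  -- Cauchy-Schwarz for `W` against the indicator of its support.
  have h := ENNReal.lintegral_mul_le_Lp_mul_Lq ν Real.HolderConjugate.two_two hW.aemeasurable
    ((measurable_one.indicator hS).aemeasurable (f := {a | W a ≠ 0}.indicator 1))
  have e1 : ∀ a, (W * ({a | W a ≠ 0}.indicator 1 : α → ℝ≥0∞)) a = W a := by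
    intro a
    by_cases ha : W a = 0 <;> simp [ha]
  have e2 : ∀ a, ({a | W a ≠ 0}.indicator (1 : α → ℝ≥0∞) a) ^ (2 : ℝ) =
      {a | W a ≠ 0}.indicator 1 a := by
    intro a
    by_cases ha : W a = 0 <;> simp [ha]
  simp_rw [e1, e2, ENNReal.rpow_two] at h
  rw [lintegral_indicator_one hS] at h
  refine (pow_le_pow_left₀ zero_le h 2).trans (le_of_eq ?_)
  rw [mul_pow, ← ENNReal.rpow_natCast, ← ENNReal.rpow_natCast, ← ENNReal.rpow_mul,
    ← ENNReal.rpow_mul]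
  norm_num

variable [IsProbabilityMeasure μ]

/-- Fubini gives both moments of the vacant area, the square having area one. The constant arises by
extending the inner integral of the error term from the square to the whole plane. -/
lemma IsPoissonProcess.sq_le_mul_measure_vacancy_pos (hX : IsPoissonProcess μ lam X)
    (hlam : 0 < lam) {r : ℝ} (hr : 0 < r) (k : ℕ) :
    ENNReal.ofReal (poissonBelow k (lam * (Real.pi * r ^ 2))) ^ 2 ≤
      ENNReal.ofReal (poissonBelow k (lam * (Real.pi * r ^ 2))) *
        (ENNReal.ofReal (poissonBelow k (lam * (Real.pi * r ^ 2))) +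
          ENNReal.ofReal (Real.pi * k * (k + 1) / (lam * (Real.pi * r / 2)) ^ 2)) *
        μ {ω | 0 < vacancy X r unitSquare k ω} := by
  set P := ENNReal.ofReal (poissonBelow k (lam * (Real.pi * r ^ 2))) with hP
  set C := ENNReal.ofReal (Real.pi * k * (k + 1) / (lam * (Real.pi * r / 2)) ^ 2) with hC
  let ρ : Measure Plane := volume.restrict unitSquare
  have hρ : IsProbabilityMeasure ρ := ⟨by rw [Measure.restrict_apply_univ, volume_unitSquare]⟩
  let S : Set (Plane × Ω) := {p | Set.encard {i : ℕ | p.1 ∈ Metric.closedBall (X i p.2) r} < k}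
  have hS : MeasurableSet S := hX.measurableSet_vacant r k
  let W : Ω → ℝ≥0∞ := fun ω => ρ ((fun x => (x, ω)) ⁻¹' S)
  have hWm : Measurable W := measurable_measure_prodMk_right hS
  have hWv : ∀ ω, W ω = volume (vacant (fun i => X i ω) r k) := by
    intro ω
    rw [show W ω = ρ ((fun x => (x, ω)) ⁻¹' S) from rfl,
      Measure.restrict_apply (measurable_prodMk_right hS), Set.inter_comm]
    rfl
  have hW1 : ∫⁻ ω, W ω ∂μ = P := by
    rw [← Measure.prod_apply_symm hS, Measure.prod_apply hS]
    have : ∀ x, μ (Prod.mk x ⁻¹' S) = P := fun x => hX.measure_vacantEvent hlam.le hr.le k x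
    simp_rw [this]
    simp
  have hW2 : ∫⁻ ω, W ω ^ 2 ∂μ ≤ P * (P + C) := by
    let S₂ : Set ((Plane × Plane) × Ω) := {p | (p.1.1, p.2) ∈ S ∧ (p.1.2, p.2) ∈ S}
    have hS₂ : MeasurableSet S₂ :=
      (((measurable_fst.fst).prodMk measurable_snd) hS).inter
        (((measurable_fst.snd).prodMk measurable_snd) hS)
    have h1 : ∀ ω, W ω ^ 2 = (ρ.prod ρ) ((fun z => (z, ω)) ⁻¹' S₂) := by
      intro ω
      rw [sq, ← Measure.prod_prod]
      rfl
    simp_rw [h1]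
    rw [← Measure.prod_apply_symm hS₂, Measure.prod_apply hS₂]
    have hcont : Continuous fun z : Plane × Plane =>
        poissonBelow k (lam * (Real.pi * r / 2) * dist z.1 z.2) :=
      (continuous_poissonBelow k).comp (by fun_prop)
    have hg : Measurable fun z : Plane × Plane =>
        ENNReal.ofReal (poissonBelow k (lam * (Real.pi * r / 2) * dist z.1 z.2)) :=
      hcont.measurable.ennreal_ofReal
    calc _ ≤ ∫⁻ z, P * (P + ENNReal.ofReal (poissonBelow k (lam * (Real.pi * r / 2) *
            dist z.1 z.2))) ∂(ρ.prod ρ) :=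
          lintegral_mono fun z => hX.measure_vacantEvent_inter_le hlam.le hr k z.1 z.2
      _ = P * (P + ∫⁻ z, ENNReal.ofReal (poissonBelow k (lam * (Real.pi * r / 2) *
            dist z.1 z.2)) ∂(ρ.prod ρ)) := by
          rw [lintegral_const_mul _ (hg.const_add _), lintegral_add_left measurable_const]
          simp
      _ ≤ P * (P + C) := by
          gcongr
          rw [lintegral_prod _ hg.aemeasurable]
          calc _ ≤ ∫⁻ x, C ∂ρ := by
                refine lintegral_mono fun x => ?_
                refine (setLIntegral_le_lintegral _ _).trans (le_of_eq ?_)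
                exact lintegral_poissonBelow_dist k (by positivity) x
            _ = C := by simp
  have h := sq_lintegral_le_lintegral_sq_mul (ν := μ) hWm
  rw [hW1] at h
  refine h.trans (mul_le_mul' hW2 (measure_mono fun ω hω => ?_))
  refine vacancy_pos_of_volume_vacant_ne_zero ?_
  rw [← hWv]
  exact hω

lemma IsPoissonProcess.le_measureReal_vacancy_pos (hX : IsPoissonProcess μ lam X)
    (hlam : 0 < lam) {r : ℝ} (hr : 0 < r) {k : ℕ} (hk : 1 ≤ k) :
    1 / (1 + 4 * ((k + 1)! : ℝ) /
      (Real.exp (-(lam * Real.pi * r ^ 2)) * lam * (lam * Real.pi * r ^ 2) ^ k)) ≤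
      μ.real {ω | 0 < vacancy X r unitSquare k ω} := by
  have hpi := Real.pi_pos
  set a := lam * Real.pi * r ^ 2 with ha
  have ha0 : 0 < a := by positivity
  have e1 : lam * (Real.pi * r ^ 2) = a := by rw [ha]; ring
  have h := hX.sq_le_mul_measure_vacancy_pos hlam hr k
  rw [e1] at h
  set p := poissonBelow k a with hp
  set C := Real.pi * k * (k + 1) / (lam * (Real.pi * r / 2)) ^ 2 with hC
  set Q := μ.real {ω | 0 < vacancy X r unitSquare k ω} with hQ
  obtain ⟨n, rfl⟩ : ∃ n, k = n + 1 := ⟨k - 1, by omega⟩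
  have hpn : Real.exp (-a) * (a ^ n / (n ! : ℝ)) ≤ p := by
    rw [hp, poissonBelow]
    refine mul_le_mul_of_nonneg_left ?_ (Real.exp_pos _).le
    exact Finset.single_le_sum (f := fun i : ℕ => a ^ i / (i ! : ℝ))
      (fun i _ => by positivity) (Finset.self_mem_range_succ n)
  have hp0 : 0 < p := lt_of_lt_of_le (by positivity) hpn
  have hC0 : 0 ≤ C := by positivity
  have hQ0 : 0 ≤ Q := measureReal_nonneg
  have h1 : p ^ 2 ≤ p * (p + C) * Q := by
    rw [← ofReal_measureReal, ← ENNReal.ofReal_pow hp0.le, ← ENNReal.ofReal_add hp0.le hC0,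
      ← ENNReal.ofReal_mul hp0.le, ← ENNReal.ofReal_mul (by positivity)] at h
    exact (ENNReal.ofReal_le_ofReal_iff (by positivity)).1 h
  have h2 : p ≤ (p + C) * Q := by
    refine le_of_mul_le_mul_left ?_ hp0
    nlinarith
  set θ := 4 * ((n + 1 + 1)! : ℝ) / (Real.exp (-a) * lam * a ^ (n + 1)) with hθ
  have hθ0 : 0 ≤ θ := by positivity
  -- The form of `θ` is explained here: `θ` times the last term `e^{-a} a^n / n!` of `p` equals `C`
  -- exactly.
  have hCθ : C ≤ θ * p := by
    refine le_trans (le_of_eq ?_) (mul_le_mul_of_nonneg_left hpn hθ0)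
    rw [hC, hθ, Nat.factorial_succ, Nat.factorial_succ]
    have : (n ! : ℝ) ≠ 0 := by positivity
    have hlam' := hlam.ne'
    push_cast
    field_simp
    rw [ha]
    ring
  rw [div_le_iff₀ (by positivity)]
  refine le_of_mul_le_mul_left ?_ hp0
  nlinarith

end KCoverage

theorem mainTheorem4 {Ω : Type*} [MeasurableSpace Ω] (μ : Measure Ω) [IsProbabilityMeasure μ]
    (lam r : ℝ) (hlam : 0 < lam) (hr : 0 < r) (hr1 : Real.pi * r ^ 2 ≤ 1)
    (k : ℕ) (hk : 1 ≤ k)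
    (X : ℕ → Ω → EuclideanSpace ℝ (Fin 2)) (hX : KCoverage.IsPoissonProcess μ lam X)
    (θ : ℝ)
    (hθ : θ = 4 * ((k + 1)! : ℝ) /
      (Real.exp (-(lam * Real.pi * r ^ 2)) * lam * (lam * Real.pi * r ^ 2) ^ k)) :
    1 / (1 + θ) ≤ μ.real {ω | 0 < KCoverage.vacancy X r KCoverage.unitSquare k ω} ∧
    μ.real {ω | 0 < KCoverage.vacancy X r KCoverage.unitSquare k ω} ≤
      2 * Real.exp (-(lam * Real.pi * r ^ 2)) *
        (1 + lam ^ 2 * Real.pi * r ^ 2 * (1 + 2 / (lam * Real.pi * r)) *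
          ∑ i ∈ Finset.range k, (lam * Real.pi * r ^ 2) ^ i / (i ! : ℝ)) := by
  subst hθ
  exact ⟨hX.le_measureReal_vacancy_pos hlam hr hk,
    hX.measureReal_vacancy_pos_le_closed_form hlam hr hr1 hk⟩
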